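/- Fix countably infinite sets of atoms, agents and skills. A model $(W,E,C,\beta)$ consists of a nonempty set $W$ of worlds, a symmetric function $E$ from $W\times W$ to sets of skills such that $E(w,u)$ is the set of all skills only if $w=u$, a function $C$ from agents to sets of skills, and a valuation $\beta$ from $W$ to sets of atoms. The language $\mathcal L_\boxplus$ is $\phi::=p\mid\neg\phi\mid(\phi\to\phi)\mid K_a\phi\mid\boxplus_a\phi$, where $K_a\phi$ holds at $w$ iff $\phi$ holds at every $u$ with $C(a)\subseteq E(w,u)$, and $\boxplus_a\phi$ holds at $w$ iff for every finite nonempty set $S$ of skills $\phi$ holds at $w$ after $C(a)$ has been replaced by $C(a)\cup S$. Let $\hat K_a=\neg K_a\neg$ and let $\boxtimes_a=\neg\boxplus_a\neg$ be the dual of $\boxplus_a$. The model checking problem for $\mathcal L_\boxplus$ asks, given a finite model $M$ (with finite skill sets and sets of atoms, and with $C$ listed on a finite set of agents that contains the agents of the formula), a world $w$ and a formula $\phi$, whether $M,w\models\phi$. Let $G=(D,R)$ be a finite undirected graph without loops, with $D\neq\emptyset$, and let $d\in D$. In undirected edge geography on $(G,d)$ two players alternately choose an edge at the current node that has not been chosen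 before, and move to its other end; the game starts at $d$ with Player I, and a player who cannot choose an edge loses. The problem is to decide, given $(G,d)$, whether Player I has a winning strategy. The induced model is $M_G=(D,E,C,\beta)$ with $E(x,y)=\{s_{\{x,y\}}\}$ if $\{x,y\}\in R$ and $E(x,y)=\emptyset$ otherwise, $C(a)=\emptyset$ for all agents $a$, and $\beta(x)=\{p_x\}$, where the skills $s_{\{x,y\}}$ are pairwise distinct, and so are the atoms $p_x$. The induced formula $\phi_G$ uses distinct agents $a_1,\dots,a_n$, where $n$ is the smallest positive even number with $n\ge|R|$ (the number of edges). For $1\le i\le n$ let $$\psi_i=\neg K_{a_i}\bot\wedge\bigvee_{x\in D}K_{a_i}p_x,\qquad \chi_i=\bigvee_{x\ne y\in D,\ 1\le j<i}(p_x\wedge\hat K_{a_j}p_y\wedge K_{a_i}p_y),$$ where the empty disjunction is $\bot$, let $$\theta_{n-1}=\boxtimes_{a_{n-1}}\bigl(\psi_{n-1}\wedge\neg\chi_{n-1}\wedge K_{a_{n-1}}\boxplus_{a_n}(\neg\psi_n\vee\chi_n)\bigr),$$ $$\theta_i=\boxtimes_{a_i}\bigl(\psi_i\wedge\neg\chi_i\wedge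 K_{a_i}\boxplus_{a_{i+1}}(\neg\psi_{i+1}\vee\chi_{i+1}\vee\hat K_{a_{i+1}}\theta_{i+2})\bigr)\quad(i<n-1\text{ odd}),$$ and let $\phi_G=\theta_1$. Corollary. Undirected edge geography is polynomial-time many-one reducible to the model checking problem for $\mathcal L_\boxplus$. More precisely, the map $(G,d)\mapsto(M_G,d,\phi_G)$ is such a reduction: it is computable in polynomial time by a Turing machine, and Player I has a winning strategy on $(G,d)$ if and only if $M_G,d\models\phi_G$. Moreover, there is a polynomial $p$ such that for every $(G,d)$ the size of $M_G$ and the length of $\phi_G$ (numbers of symbols, each name counted as one symbol) are at most $p(|D|+|R|)$. -/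

import Mathlib

namespace EpistemicSkills

/-! ### Many-one reductions in polynomial time -/

/-- `f` is a polynomial-time many-one reduction of the decision problem `P` to the decision
problem `Q`, with respect to encodings of the instances as words over finite alphabets: some
Turing machine computes `f` in polynomially many steps, and `f` maps the yes-instances of `P`,
and only these, to yes-instances of `Q`. -/
def IsPolyTimeReduction {α β Γ₁ Γ₂ : Type} [Fintype Γ₁] [Fintype Γ₂]
    (ea : Computability.Encoding α Γ₁) (eb : Computability.Encoding β Γ₂)
    (P : α → Prop) (Q : β → Prop) (f : α → β) : Prop :=
  Nonempty (Turing.TM2ComputableInPolyTime ea.encode eb.encode f) ∧ ∀ a, P a ↔ Q (f a)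

/-- `P` is polynomial-time (many-one) reducible to `Q`. -/
def PolyTimeReducible {α β Γ₁ Γ₂ : Type} [Fintype Γ₁] [Fintype Γ₂]
    (ea : Computability.Encoding α Γ₁) (eb : Computability.Encoding β Γ₂)
    (P : α → Prop) (Q : β → Prop) : Prop :=
  ∃ f : α → β, IsPolyTimeReduction ea eb P Q f

/-! ### The language with individual knowledge and the upskilling quantifier -/

/-- Formulas `φ ::= p | ¬φ | (φ → φ) | K_a φ | ⊞_a φ`. The atoms `p`, the agents `a` and, below, the
skills are natural numbers: three countably infinite sets. -/
inductive Formula : Type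
  | atom (p : ℕ) : Formula
  | neg (φ : Formula) : Formula
  | imp (φ ψ : Formula) : Formula
  | know (a : ℕ) (φ : Formula) : Formula
  | boxplus (a : ℕ) (φ : Formula) : Formula

namespace Formula

/-- `⊥`, as `¬(p → p)`. -/
def bot : Formula := neg (imp (atom 0) (atom 0))

/-- `φ ∨ ψ`, as `¬φ → ψ`. -/
def or (φ ψ : Formula) : Formula := imp (neg φ) ψ

/-- `φ ∧ ψ`, as `¬(φ → ¬ψ)`. -/
def and (φ ψ : Formula) : Formula := neg (imp φ (neg ψ))

/-- The dual of `K_a`. -/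
def possible (a : ℕ) (φ : Formula) : Formula := neg (know a (neg φ))

/-- The dual of `⊞_a`. -/
def diamondplus (a : ℕ) (φ : Formula) : Formula := neg (boxplus a (neg φ))

/-- The disjunction of a list of formulas; the empty disjunction is `⊥`. -/
def bigOr (l : List Formula) : Formula := l.foldr or bot

/-- The length of a formula: the number of its symbols, brackets included. -/
def length : Formula → ℕ
  | atom _ => 1
  | neg φ => φ.length + 1
  | imp φ ψ => φ.length + ψ.length + 3
  | know _ φ => φ.length + 2
  | boxplus _ φ => φ.length + 2

/-- The agents that occur in a formula. -/
def agents : Formula → Finset ℕ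
  | atom _ => ∅
  | neg φ => φ.agents
  | imp φ ψ => φ.agents ∪ ψ.agents
  | know a φ => insert a φ.agents
  | boxplus a φ => insert a φ.agents

end Formula

/-! ### Semantics -/

/-- Models `(W, E, C, β)`. -/
structure Model (W : Type) where
  nonempty : Nonempty W
  /-- the edge function -/
  E : W → W → Set ℕ
  /-- the capability function -/
  C : ℕ → Set ℕ
  /-- the valuation -/
  β : W → Set ℕ
  positivity : ∀ w u, E w u = Set.univ → w = u
  symmetry : ∀ w u, E w u = E u w

/-- The model `(W, E, C^{a+S}, β)` in which the skills `S` are added to those of agent `a`. -/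
def Model.upskill {W : Type} (M : Model W) (a : ℕ) (S : Set ℕ) : Model W :=
  { M with C := Function.update M.C a (M.C a ∪ S) }

/-- Satisfaction `M, w ⊨ φ`. -/
def Sat {W : Type} (M : Model W) (w : W) : Formula → Prop
  | .atom p => p ∈ M.β w
  | .neg φ => ¬ Sat M w φ
  | .imp φ ψ => Sat M w φ → Sat M w ψ
  | .know a φ => ∀ u : W, M.C a ⊆ M.E w u → Sat M u φ
  | .boxplus a φ => ∀ S : Finset ℕ, S.Nonempty → Sat (M.upskill a (S : Set ℕ)) w φ

/-! ### The model checking problem -/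

/-- Finite models as they are given as inputs: the worlds are `0, …, worlds - 1`, all skill sets
and all sets of atoms are finite, and the capability function is given on a finite set of
agents (the other agents have no skills). -/
structure FinModel where
  worlds : ℕ
  worlds_pos : 0 < worlds
  E : Fin worlds → Fin worlds → Finset ℕ
  symmetry : ∀ w u, E w u = E u w
  agents : Finset ℕ
  C : ℕ → Finset ℕ
  C_eq_empty : ∀ a, a ∉ agents → C a = ∅
  β : Fin worlds → Finset ℕ

/-- The model that is given by a finite model; positivity holds as there are infinitely many
skills. -/
def FinModel.toModel (M : FinModel) : Model (Fin M.worlds) where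
  nonempty := ⟨⟨0, M.worlds_pos⟩⟩
  E w u := (M.E w u : Set ℕ)
  C a := (M.C a : Set ℕ)
  β w := (M.β w : Set ℕ)
  positivity w u h := by
    exfalso
    have hf : (Set.univ : Set ℕ).Finite := by
      rw [← h]
      exact (M.E w u).finite_toSet
    exact Set.infinite_univ hf
  symmetry w u := by rw [M.symmetry w u]

/-- The number of symbols of a finite set `{x, …, y}` of names, braces and commas included
(one symbol for `∅`). -/
def setSymbols (s : Finset ℕ) : ℕ := 2 * s.card + 1

/-- The size of a finite model: the number of worlds, plus the numbers of symbols of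
`E = {(w, u, S), …}`, of `C = {(a, S), …}` on the given set of agents, and of
`β = {(w, Φ), …}`. -/
def FinModel.size (M : FinModel) : ℕ :=
  M.worlds
    + (1 + ∑ w : Fin M.worlds, ∑ u : Fin M.worlds, (setSymbols (M.E w u) + 7))
    + (1 + ∑ a ∈ M.agents, (setSymbols (M.C a) + 5))
    + (1 + ∑ w : Fin M.worlds, (setSymbols (M.β w) + 5))

/-- Instances of the model checking problem: a finite model, a world of it, and a formula. The
agents for which the capability function is given include all agents of the formula. -/
structure MCInstance where
  model : FinModel
  world : Fin model.worlds
  formula : Formula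
  agents_subset : formula.agents ⊆ model.agents

/-- The model checking problem: does `M, w ⊨ φ` hold? -/
def ModelChecking (I : MCInstance) : Prop := Sat I.model.toModel I.world I.formula

/-! ### Words that encode instances of the model checking problem -/

/-- The alphabet: `tick` and `sep` for names, `close` for the end of a set, and a letter for
every clause of the grammar. -/
inductive Token : Type
  | tick | sep | close | atom | neg | imp | know | boxplus
  deriving DecidableEq

instance : Fintype Token where
  elems := {.tick, .sep, .close, .atom, .neg, .imp, .know, .boxplus}
  complete t := by cases t <;> decide

/-- Names are written in unary. -/
def encodeName (k : ℕ) : List Token := List.replicate k Token.tick ++ [Token.sep]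

/-- A finite set of names is written as the list of its elements in increasing order. -/
def encodeSet (s : Finset ℕ) : List Token :=
  (s.sort (· ≤ ·)).flatMap encodeName ++ [Token.close]

/-- Formulas are written in prefix notation. -/
def encodeFormula : Formula → List Token
  | .atom p => Token.atom :: encodeName p
  | .neg φ => Token.neg :: encodeFormula φ
  | .imp φ ψ => Token.imp :: (encodeFormula φ ++ encodeFormula ψ)
  | .know a φ => Token.know :: (encodeName a ++ encodeFormula φ)
  | .boxplus a φ => Token.boxplus :: (encodeName a ++ encodeFormula φ)

/-- An instance is written as the number of worlds, the designated world, the table of `E`, the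
set of agents, the table of `C` on it, the table of `β`, and the formula. -/
def encodeMC (I : MCInstance) : List Token :=
  encodeName I.model.worlds ++ (encodeName (I.world : ℕ) ++
    ((List.finRange I.model.worlds).flatMap (fun w =>
        (List.finRange I.model.worlds).flatMap (fun u => encodeSet (I.model.E w u))) ++
      (encodeSet I.model.agents ++
        ((I.model.agents.sort (· ≤ ·)).flatMap (fun a => encodeSet (I.model.C a)) ++
          ((List.finRange I.model.worlds).flatMap (fun w => encodeSet (I.model.β w)) ++
            encodeFormula I.formula)))))

theorem encodeName_append {k l : ℕ} {u v : List Token}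
    (h : encodeName k ++ u = encodeName l ++ v) : k = l ∧ u = v := by
  induction k generalizing l with
  | zero =>
    cases l with
    | zero => simpa [encodeName] using h
    | succ l => simp [encodeName, List.replicate_succ] at h
  | succ k ih =>
    cases l with
    | zero => simp [encodeName, List.replicate_succ] at h
    | succ l =>
      have h2 : encodeName k ++ u = encodeName l ++ v := by
        simpa [encodeName, List.replicate_succ] using h
      obtain ⟨h3, h4⟩ := ih h2
      exact ⟨by rw [h3], h4⟩

theorem encodeNames_append {k l : List ℕ} {u v : List Token}
    (h : k.flatMap encodeName ++ Token.close :: u = l.flatMap encodeName ++ Token.close :: v) :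
    k = l ∧ u = v := by
  have key : ∀ (a : ℕ) (x y : List Token), encodeName a ++ x ≠ Token.close :: y := by
    intro a x y
    cases a <;> simp [encodeName, List.replicate_succ]
  induction k generalizing l with
  | nil =>
    cases l with
    | nil => simpa using h
    | cons b l =>
      rw [List.flatMap_cons, List.append_assoc] at h
      exact absurd h.symm (key _ _ _)
  | cons a k ih =>
    cases l with
    | nil =>
      rw [List.flatMap_cons, List.append_assoc] at h
      exact absurd h (key _ _ _)
    | cons b l =>
      rw [List.flatMap_cons, List.flatMap_cons, List.append_assoc, List.append_assoc] at h
      obtain ⟨h1, h2⟩ := encodeName_append h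
      obtain ⟨h3, h4⟩ := ih h2
      exact ⟨by rw [h1, h3], h4⟩

theorem encodeSet_append {s t : Finset ℕ} {u v : List Token}
    (h : encodeSet s ++ u = encodeSet t ++ v) : s = t ∧ u = v := by
  simp only [encodeSet, List.append_assoc, List.singleton_append] at h
  obtain ⟨h1, h2⟩ := encodeNames_append h
  refine ⟨?_, h2⟩
  have h3 := congrArg List.toFinset h1
  simpa using h3

theorem encodeFormula_append {φ ψ : Formula} {u v : List Token}
    (h : encodeFormula φ ++ u = encodeFormula ψ ++ v) : φ = ψ ∧ u = v := by
  induction φ generalizing ψ u v with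
  | atom p =>
    cases ψ <;> simp [encodeFormula] at h
    obtain ⟨h1, h2⟩ := encodeName_append h
    exact ⟨by rw [h1], h2⟩
  | neg φ ih =>
    cases ψ <;> simp [encodeFormula] at h
    obtain ⟨h1, h2⟩ := ih h
    exact ⟨by rw [h1], h2⟩
  | imp φ χ ih1 ih2 =>
    cases ψ <;> simp [encodeFormula] at h
    obtain ⟨h1, h2⟩ := ih1 h
    obtain ⟨h3, h4⟩ := ih2 h2
    exact ⟨by rw [h1, h3], h4⟩
  | know a φ ih =>
    cases ψ <;> simp [encodeFormula] at h
    obtain ⟨h1, h2⟩ := encodeName_append h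
    obtain ⟨h3, h4⟩ := ih h2
    exact ⟨by rw [h1, h3], h4⟩
  | boxplus a φ ih =>
    cases ψ <;> simp [encodeFormula] at h
    obtain ⟨h1, h2⟩ := encodeName_append h
    obtain ⟨h3, h4⟩ := ih h2
    exact ⟨by rw [h1, h3], h4⟩

theorem encodeTable_append {ι : Type} {f g : ι → List Token} {R : ι → Prop}
    (hfg : ∀ i x y, f i ++ x = g i ++ y → R i ∧ x = y) (l : List ι) {u v : List Token}
    (h : l.flatMap f ++ u = l.flatMap g ++ v) : (∀ i ∈ l, R i) ∧ u = v := by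
  induction l with
  | nil => simpa using h
  | cons a l ih =>
    rw [List.flatMap_cons, List.flatMap_cons, List.append_assoc, List.append_assoc] at h
    obtain ⟨h1, h2⟩ := hfg _ _ _ h
    obtain ⟨h3, h4⟩ := ih h2
    refine ⟨?_, h4⟩
    intro i hi
    rcases List.mem_cons.1 hi with rfl | hi
    · exact h1
    · exact h3 i hi

theorem encodeMC_injective : Function.Injective encodeMC := by
  rintro ⟨⟨m, hm, E, hE, A, C, hC, β⟩, w, φ, hφ⟩ ⟨⟨m', hm', E', hE', A', C', hC', β'⟩, w', φ', hφ'⟩ h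
  simp only [encodeMC] at h
  obtain ⟨rfl, h⟩ := encodeName_append h
  obtain ⟨hw, h⟩ := encodeName_append h
  obtain ⟨hEE, h⟩ := encodeTable_append (R := fun w => ∀ u ∈ List.finRange m, E w u = E' w u)
    (fun w x y hxy => encodeTable_append (R := fun u => E w u = E' w u)
      (fun u x y hxy => encodeSet_append hxy) _ hxy) _ h
  obtain ⟨rfl, h⟩ := encodeSet_append h
  obtain ⟨hCC, h⟩ := encodeTable_append (R := fun a => C a = C' a)
    (fun a x y hxy => encodeSet_append hxy) _ h
  obtain ⟨hββ, h⟩ := encodeTable_append (R := fun w => β w = β' w)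
    (fun w x y hxy => encodeSet_append hxy) _ h
  obtain ⟨rfl, -⟩ := encodeFormula_append (u := []) (v := []) (by simpa using h)
  obtain rfl : w = w' := Fin.ext hw
  obtain rfl : E = E' := by
    funext w u
    exact hEE w (List.mem_finRange w) u (List.mem_finRange u)
  obtain rfl : β = β' := by
    funext w
    exact hββ w (List.mem_finRange w)
  obtain rfl : C = C' := by
    funext a
    by_cases ha : a ∈ A
    · exact hCC a (by simpa using ha)
    · rw [hC a ha, hC' a ha]
  rfl

/-- The encoding of the instances of the model checking problem. -/
noncomputable def encodingMC : Computability.Encoding MCInstance Token where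
  encode := encodeMC
  decode := Function.partialInv encodeMC
  decode_encode I := Function.partialInv_left encodeMC_injective I

/-! ### Undirected edge geography -/

/-- Player I, who is to move at the node `d`, has a winning strategy in undirected edge geography
on `G`: she can choose an edge `{d, d'}` such that, once it has been removed, she has a winning
strategy again after every answer `{d', d''}` of Player II and the removal of that edge. In
particular she wins if there is no answer, and loses if she cannot choose an edge. -/
inductive FirstPlayerWins {V : Type} : SimpleGraph V → V → Prop
  | move {G : SimpleGraph V} {d : V} (d' : V) (hd : G.Adj d d')
      (h : ∀ d'' : V, (G.deleteEdges {s(d, d')}).Adj d' d'' →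
        FirstPlayerWins ((G.deleteEdges {s(d, d')}).deleteEdges {s(d', d'')}) d'') :
      FirstPlayerWins G d

/-- Rooted undirected graphs with the nodes `0, …, nodes - 1`. -/
structure RootedGraph where
  nodes : ℕ
  graph : SimpleGraph (Fin nodes)
  root : Fin nodes

/-- The undirected edge geography problem: does Player I have a winning strategy? -/
def UEG (g : RootedGraph) : Prop := FirstPlayerWins g.graph g.root

/-- The number of edges. -/
noncomputable def RootedGraph.edges (g : RootedGraph) : ℕ := g.graph.edgeSet.ncard

open Classical in
/-- A rooted graph is written as the number of nodes and the root, both in unary, followed by the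
adjacency matrix, row by row. -/
noncomputable def encodeGraph (g : RootedGraph) : List Bool :=
  List.replicate g.nodes true ++ false :: (List.replicate (g.root : ℕ) true ++ false ::
    (List.finRange g.nodes).flatMap (fun x =>
      (List.finRange g.nodes).map (fun y => decide (g.graph.Adj x y))))

theorem replicate_append {k l : ℕ} {u v : List Bool}
    (h : List.replicate k true ++ false :: u = List.replicate l true ++ false :: v) :
    k = l ∧ u = v := by
  induction k generalizing l with
  | zero => cases l <;> simp_all [List.replicate_succ]
  | succ k ih =>
    cases l with
    | zero => simp [List.replicate_succ] at h
    | succ l =>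
      obtain ⟨h1, h2⟩ := ih (l := l) (by simpa [List.replicate_succ] using h)
      exact ⟨by rw [h1], h2⟩

theorem rows_injective {ι κ : Type} (l : List ι) (r : List κ) (f g : ι → κ → Bool)
    (h : l.flatMap (fun x => r.map (f x)) = l.flatMap (fun x => r.map (g x))) :
    ∀ x ∈ l, ∀ y ∈ r, f x y = g x y := by
  induction l with
  | nil => simp
  | cons a l ih =>
    rw [List.flatMap_cons, List.flatMap_cons] at h
    obtain ⟨h1, h2⟩ := List.append_inj h (by simp)
    intro x hx
    rcases List.mem_cons.1 hx with rfl | hx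
    · exact List.map_inj_left.1 h1
    · exact ih h2 x hx

theorem encodeGraph_injective : Function.Injective encodeGraph := by
  classical
  rintro ⟨n, G, d⟩ ⟨n', G', d'⟩ h
  simp only [encodeGraph] at h
  obtain ⟨rfl, h⟩ := replicate_append h
  obtain ⟨hd, h⟩ := replicate_append h
  obtain rfl : d = d' := Fin.ext hd
  obtain rfl : G = G' := by
    ext x y
    simpa using rows_injective _ _ _ _ h x (List.mem_finRange x) y (List.mem_finRange y)
  rfl

/-- The encoding of rooted undirected graphs. -/
noncomputable def encodingGraph : Computability.Encoding RootedGraph Bool where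
  encode := encodeGraph
  decode := Function.partialInv encodeGraph
  decode_encode g := Function.partialInv_left encodeGraph_injective g

/-! ### The induced model and the induced formula

The agent `a_i` is `i`, and the atom `p_x` of the node `x` is `x`. -/

/-- The skill `s_{{x, y}}`. -/
def edgeSkill {n : ℕ} (x y : Fin n) : ℕ := n * (min x y : Fin n) + (max x y : Fin n)

theorem edgeSkill_inj {n : ℕ} {x y x' y' : Fin n} :
    edgeSkill x y = edgeSkill x' y' ↔ s(x, y) = s(x', y') := by
  constructor
  · intro h
    have hn : 0 < n := lt_of_le_of_lt (Nat.zero_le _) x.2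
    have hq := congrArg (· / n) h
    have hr := congrArg (· % n) h
    simp only [edgeSkill, Nat.mul_add_div hn, Nat.mul_add_mod, Nat.div_eq_of_lt (Fin.is_lt _),
      Nat.mod_eq_of_lt (Fin.is_lt _), add_zero] at hq hr
    have hq' := Fin.ext hq
    have hr' := Fin.ext hr
    rw [Sym2.eq_iff]
    rcases le_total x y with h1 | h1 <;> rcases le_total x' y' with h2 | h2 <;>
      simp only [min_eq_left h1, min_eq_right h1, max_eq_left h1, max_eq_right h1,
        min_eq_left h2, min_eq_right h2, max_eq_left h2, max_eq_right h2] at hq' hr' <;>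
      simp [hq', hr']
  · intro h
    rcases Sym2.eq_iff.1 h with ⟨rfl, rfl⟩ | ⟨rfl, rfl⟩
    · rfl
    · simp only [edgeSkill, min_comm, max_comm]

/-- The smallest positive even number that is at least the number of edges. -/
noncomputable def numAgents (g : RootedGraph) : ℕ := 2 * max 1 ((g.edges + 1) / 2)

theorem numAgents_isLeast (g : RootedGraph) :
    IsLeast {n : ℕ | 0 < n ∧ Even n ∧ g.edges ≤ n} (numAgents g) := by
  constructor
  · refine ⟨?_, even_two_mul _, ?_⟩ <;> unfold numAgents <;> omega
  · rintro n ⟨h1, ⟨k, rfl⟩, h3⟩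
    unfold numAgents
    omega

open Classical in
/-- The induced model: `E(x, y) = {s_{{x, y}}}` for the edges, `E(x, y) = ∅` otherwise, no agent
has a skill, and `β(x) = {p_x}`. -/
noncomputable def inducedModel (g : RootedGraph) : FinModel where
  worlds := g.nodes
  worlds_pos := lt_of_le_of_lt (Nat.zero_le _) g.root.2
  E x y := if g.graph.Adj x y then {edgeSkill x y} else ∅
  symmetry x y := by
    rw [show edgeSkill x y = edgeSkill y x from edgeSkill_inj.2 Sym2.eq_swap]
    simp only [g.graph.adj_comm x y]
  agents := Finset.Icc 1 (numAgents g)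
  C _ := ∅
  C_eq_empty _ _ := rfl
  β x := {(x : ℕ)}

/-- `ψ_i = ¬K_{a_i}⊥ ∧ ⋁_x K_{a_i} p_x`: the edge of the `i`-th move starts at the current
node. -/
def psi (D i : ℕ) : Formula :=
  (Formula.neg (.know i .bot)).and
    (Formula.bigOr ((List.range D).map fun x => .know i (.atom x)))

/-- `χ_i = ⋁_{x ≠ y, 1 ≤ j < i} (p_x ∧ K̂_{a_j} p_y ∧ K_{a_i} p_y)`: the edge of the `i`-th move
has been chosen before. -/
def chi (D i : ℕ) : Formula :=
  Formula.bigOr ((List.range' 1 (i - 1)).flatMap fun (j : ℕ) =>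
    (List.range D).flatMap fun (x : ℕ) =>
      ((List.range D).filter (fun y => x ≠ y)).map fun (y : ℕ) =>
        (Formula.atom x).and ((Formula.possible j (.atom y)).and (.know i (.atom y))))

/-- The part of the induced formula that starts with the `i`-th move, which is one of Player I,
and is followed by `r` more rounds after the present one. -/
def phiFrom (D : ℕ) : (r i : ℕ) → Formula
  | 0, i =>
    .diamondplus i ((psi D i).and ((chi D i).neg.and (.know i
      (.boxplus (i + 1) ((psi D (i + 1)).neg.or (chi D (i + 1)))))))
  | r + 1, i =>
    .diamondplus i ((psi D i).and ((chi D i).neg.and (.know i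
      (.boxplus (i + 1) ((psi D (i + 1)).neg.or ((chi D (i + 1)).or
        (.possible (i + 1) (phiFrom D r (i + 2)))))))))

/-- The induced formula, for the `numAgents g / 2` rounds with the agents `1, …, numAgents g`. -/
noncomputable def inducedFormula (g : RootedGraph) : Formula :=
  phiFrom g.nodes (numAgents g / 2 - 1) 1

theorem agents_bigOr {l : List Formula} {A : Finset ℕ} (h : ∀ φ ∈ l, φ.agents ⊆ A) :
    (Formula.bigOr l).agents ⊆ A := by
  induction l with
  | nil => simp [Formula.bigOr, Formula.bot, Formula.agents]
  | cons a l ih =>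
    have h1 := h a (by simp)
    have h2 := ih fun φ hφ => h φ (by simp [hφ])
    exact Finset.union_subset h1 h2

theorem agents_psi {D i N : ℕ} (h1 : 1 ≤ i) (h2 : i ≤ N) :
    (psi D i).agents ⊆ Finset.Icc 1 N := by
  have hi : i ∈ Finset.Icc 1 N := Finset.mem_Icc.2 ⟨h1, h2⟩
  refine Finset.union_subset ?_ (agents_bigOr ?_)
  · simp [Formula.agents, Formula.bot, h1, h2]
  · intro φ hφ
    obtain ⟨x, -, rfl⟩ := List.mem_map.1 hφ
    simp [Formula.agents, h1, h2]

theorem agents_chi {D i N : ℕ} (h1 : 1 ≤ i) (h2 : i ≤ N) :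
    (chi D i).agents ⊆ Finset.Icc 1 N := by
  refine agents_bigOr ?_
  intro φ hφ
  obtain ⟨j, hj, hφ⟩ := List.mem_flatMap.1 hφ
  obtain ⟨x, -, hφ⟩ := List.mem_flatMap.1 hφ
  obtain ⟨y, -, rfl⟩ := List.mem_map.1 hφ
  rw [List.mem_range'_1] at hj
  intro b hb
  simp only [Formula.and, Formula.possible, Formula.agents, Finset.mem_union, Finset.mem_insert,
    Finset.notMem_empty, or_false, false_or] at hb
  rw [Finset.mem_Icc]
  rcases hb with rfl | rfl
  · exact ⟨hj.1, by have h3 := hj.2; omega⟩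
  · exact ⟨h1, h2⟩

theorem agents_phiFrom {D r i N : ℕ} (h1 : 1 ≤ i) (h2 : i + 2 * r + 1 ≤ N) :
    (phiFrom D r i).agents ⊆ Finset.Icc 1 N := by
  induction r generalizing i with
  | zero =>
    simp only [phiFrom, Formula.diamondplus, Formula.and, Formula.or, Formula.agents]
    have e1 := agents_psi (D := D) (i := i) (N := N) h1 (by omega)
    have e2 := agents_chi (D := D) (i := i) (N := N) h1 (by omega)
    have e3 := agents_psi (D := D) (i := i + 1) (N := N) (by omega) (by omega)
    have e4 := agents_chi (D := D) (i := i + 1) (N := N) (by omega) (by omega)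
    have m1 : i ∈ Finset.Icc 1 N := Finset.mem_Icc.2 ⟨h1, by omega⟩
    have m2 : i + 1 ∈ Finset.Icc 1 N := Finset.mem_Icc.2 ⟨by omega, by omega⟩
    simp only [Finset.insert_subset_iff, Finset.union_subset_iff]
    tauto
  | succ r ih =>
    simp only [phiFrom, Formula.diamondplus, Formula.possible, Formula.and, Formula.or,
      Formula.agents]
    have e1 := agents_psi (D := D) (i := i) (N := N) h1 (by omega)
    have e2 := agents_chi (D := D) (i := i) (N := N) h1 (by omega)
    have e3 := agents_psi (D := D) (i := i + 1) (N := N) (by omega) (by omega)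
    have e4 := agents_chi (D := D) (i := i + 1) (N := N) (by omega) (by omega)
    have m1 : i ∈ Finset.Icc 1 N := Finset.mem_Icc.2 ⟨h1, by omega⟩
    have m2 : i + 1 ∈ Finset.Icc 1 N := Finset.mem_Icc.2 ⟨by omega, by omega⟩
    have e5 := ih (i := i + 2) (by omega) (by omega)
    simp only [Finset.insert_subset_iff, Finset.union_subset_iff]
    tauto

/-- The instance `M_G, d ⊨ φ_G` of the model checking problem. -/
noncomputable def inducedInstance (g : RootedGraph) : MCInstance where
  model := inducedModel g
  world := g.root
  formula := inducedFormula g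
  agents_subset := by
    refine agents_phiFrom le_rfl ?_
    unfold numAgents
    omega

end EpistemicSkills

open EpistemicSkills

/-!
**The game.** Before the `i`-th move the agents `j < i` hold the skills of the edges chosen so far,
and all others hold none (`Position`). An agent with the single skill `s_{x,y}` considers exactly
`y` possible at `x`, and an agent with any other nonempty set of skills considers nothing possible
there. Hence `psi` says that agent `i` has received the skill of an edge at the current node, and
`chi` that this edge has been chosen before; the quantifiers `⊠` and `⊞` then range over the legal
moves, and `K` and `K̂` follow the chosen edge. So `phiFrom` unfolds the recursion that defines
`FirstPlayerWins`, and its number of rounds suffices, as each move uses up an edge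
(`Position.sat_phiFrom`).

**The machine.** A Turing machine for the reduction is obtained in three layers. Structured programs
over counters and three stacks are translated into stack machines that simulate them step by step
(`Runs.iterate_step`). Output generators (`Gen`), nested loops over counters that print a word and
otherwise leave the memory alone, are compiled to such programs. The values of the loop variables are
bounded by linear functions of the counters in scope, so every generator has a polynomial time
bound, defined by recursion (`Gen.takes_compile`). Finally, the encoded instance is the value of one
explicit generator (`Gen.eval_inducedInstance`): in prefix notation each round of the formula only
adds a prefix to the next, so that a loop over the rounds prints the formula. The generator needs
the number of nodes, the root and the number of rounds; the last is found by counting the ones of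
the adjacency matrix, which are twice as many as the edges.
-/

namespace EpistemicSkills

/-! ### The game played in the induced model -/

theorem firstPlayerWins_iff {V : Type} {G : SimpleGraph V} {d : V} :
    FirstPlayerWins G d ↔ ∃ y, G.Adj d y ∧ ∀ z, (G.deleteEdges {s(d, y)}).Adj y z →
      FirstPlayerWins ((G.deleteEdges {s(d, y)}).deleteEdges {s(y, z)}) z := by
  constructor
  · rintro ⟨y, h1, h2⟩
    exact ⟨y, h1, h2⟩
  · rintro ⟨y, h1, h2⟩
    exact .move y h1 h2

open Classical in
/-- The position of the game before the `i`-th move, as seen in the model: `M` is the induced model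
of `G` except that each agent `j < i` has learnt the skill of the edge chosen in the `j`-th move,
and `H` consists of the edges that have not been chosen. That the skills of an agent `j < i` are
those of one edge need not be recorded: `chi` compares them with the skill of the present edge, for
which `past` and `adj_iff` suffice. -/
structure Position {n : ℕ} (G : SimpleGraph (Fin n)) (M : Model (Fin n)) (i : ℕ)
    (H : SimpleGraph (Fin n)) : Prop where
  E_eq : ∀ x y, M.E x y = if G.Adj x y then {edgeSkill x y} else ∅
  β_eq : ∀ x, M.β x = {(x : ℕ)}
  future : ∀ j, i ≤ j → M.C j = ∅
  past : ∀ j, 1 ≤ j → j < i → (M.C j).Nonempty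
  adj_iff : ∀ x y, H.Adj x y ↔ G.Adj x y ∧ ∀ j, 1 ≤ j → j < i → M.C j ≠ {edgeSkill x y}

theorem sat_and {W : Type} {M : Model W} {w : W} {φ ψ : Formula} :
    Sat M w (φ.and ψ) ↔ Sat M w φ ∧ Sat M w ψ := by
  simp [Formula.and, Sat]

theorem sat_or {W : Type} {M : Model W} {w : W} {φ ψ : Formula} :
    Sat M w (φ.or ψ) ↔ Sat M w φ ∨ Sat M w ψ := by
  simp only [Formula.or, Sat]
  tauto

theorem sat_neg {W : Type} {M : Model W} {w : W} {φ : Formula} :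
    Sat M w φ.neg ↔ ¬ Sat M w φ := Iff.rfl

theorem not_sat_bot {W : Type} {M : Model W} {w : W} : ¬ Sat M w Formula.bot := by
  simp [Formula.bot, Sat]

theorem sat_bigOr {W : Type} {M : Model W} {w : W} {l : List Formula} :
    Sat M w (Formula.bigOr l) ↔ ∃ φ ∈ l, Sat M w φ := by
  induction l with
  | nil => simp [Formula.bigOr, not_sat_bot]
  | cons a l ih =>
    have : Formula.bigOr (a :: l) = a.or (Formula.bigOr l) := rfl
    rw [this, sat_or, ih]
    simp

theorem sat_possible {W : Type} {M : Model W} {w : W} {a : ℕ} {φ : Formula} :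
    Sat M w (.possible a φ) ↔ ∃ u, M.C a ⊆ M.E w u ∧ Sat M u φ := by
  simp [Formula.possible, Sat]

theorem sat_diamondplus {W : Type} {M : Model W} {w : W} {a : ℕ} {φ : Formula} :
    Sat M w (.diamondplus a φ) ↔
      ∃ S : Finset ℕ, S.Nonempty ∧ Sat (M.upskill a (S : Set ℕ)) w φ := by
  simp [Formula.diamondplus, Sat]

theorem ncard_deleteEdges_lt {V : Type} [Finite V] {H : SimpleGraph V}
    {x y : V} (h : H.Adj x y) :
    (H.deleteEdges {s(x, y)}).edgeSet.ncard < H.edgeSet.ncard := by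
  refine Set.ncard_lt_ncard ?_ (Set.toFinite _)
  rw [SimpleGraph.edgeSet_deleteEdges]
  refine ⟨Set.sdiff_subset, fun h1 => ?_⟩
  exact (h1 ((SimpleGraph.mem_edgeSet H).2 h)).2 rfl

namespace Position

variable {n : ℕ} {G H : SimpleGraph (Fin n)} {M : Model (Fin n)} {i : ℕ}

theorem upskill_C_self (h : Position G M i H) (S : Set ℕ) : (M.upskill i S).C i = S := by
  simp [Model.upskill, h.future i le_rfl]

theorem upskill_C_of_ne {j : ℕ} (S : Set ℕ) (hj : j ≠ i) : (M.upskill i S).C j = M.C j := by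
  simp [Model.upskill, hj]

theorem subset_E_iff (hE : Position G M i H) {S : Set ℕ} (hS : S.Nonempty) {x u : Fin n} :
    S ⊆ M.E x u ↔ G.Adj x u ∧ S = {edgeSkill x u} := by
  rw [hE.E_eq]
  split_ifs with h
  · simp [h, Set.Nonempty.subset_singleton_iff hS]
  · simp [h, Set.subset_empty_iff, hS.ne_empty]

/-- An agent whose only skill is that of the edge `{x, y}` considers exactly `y` possible at `x`. -/
theorem singleton_subset_E_iff (hE : Position G M i H) {x y u : Fin n} (hxy : G.Adj x y) :
    {edgeSkill x y} ⊆ M.E x u ↔ u = y := by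
  rw [hE.subset_E_iff (Set.singleton_nonempty _)]
  constructor
  · rintro ⟨-, h⟩
    have h2 := edgeSkill_inj.1 (Set.singleton_injective h)
    exact (Sym2.congr_right.1 h2).symm
  · rintro rfl
    exact ⟨hxy, rfl⟩

/-- After agent `i` has received the nonempty set of skills `S`, the formula `psi` says that `S`
is the skill of an edge at the current node. -/
theorem sat_psi (h : Position G M i H) {S : Set ℕ} (hS : S.Nonempty) {x : Fin n} :
    Sat (M.upskill i S) x (psi n i) ↔ ∃ y, G.Adj x y ∧ S = {edgeSkill x y} := by
  simp only [psi, sat_and, sat_bigOr, sat_neg, List.mem_map, List.mem_range,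
    exists_exists_and_eq_and]
  simp only [Sat, h.upskill_C_self, not_sat_bot, imp_false]
  constructor
  · rintro ⟨h1, -⟩
    push Not at h1
    obtain ⟨u, hu⟩ := h1
    exact ⟨u, (h.subset_E_iff hS).1 hu⟩
  · rintro ⟨y, hxy, rfl⟩
    have key : ∀ u, {edgeSkill x y} ⊆ (M.upskill i {edgeSkill x y}).E x u ↔ u = y :=
      fun u => h.singleton_subset_E_iff hxy
    simp only [key]
    refine ⟨by simp, y, y.2, ?_⟩
    rintro u rfl
    change _ ∈ M.β u
    simp [h.β_eq]

/-- If agent `i` has received the skill of the edge `{x, y}`, then `chi` says at `x` that this edge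
has been chosen before. -/
theorem sat_chi (h : Position G M i H) {x y : Fin n} (hxy : G.Adj x y) :
    Sat (M.upskill i {edgeSkill x y}) x (chi n i) ↔
      ∃ j, 1 ≤ j ∧ j < i ∧ M.C j = {edgeSkill x y} := by
  have key : ∀ u, {edgeSkill x y} ⊆ (M.upskill i {edgeSkill x y}).E x u ↔ u = y :=
    fun u => h.singleton_subset_E_iff hxy
  have hβ : ∀ u, (M.upskill i {edgeSkill x y}).β u = {(u : ℕ)} := h.β_eq
  simp only [chi, sat_bigOr, List.mem_flatMap, List.mem_map, List.mem_filter, List.mem_range,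
    List.mem_range'_1, decide_eq_true_eq]
  constructor
  · rintro ⟨φ, ⟨j, ⟨hj1, hj2⟩, a, -, b, ⟨-, hab⟩, rfl⟩, hs⟩
    rw [sat_and, sat_and, sat_possible] at hs
    simp only [Sat, h.upskill_C_self, key, hβ, Set.mem_singleton_iff, forall_eq] at hs
    obtain ⟨-, ⟨u, hu, hbu⟩, hby⟩ := hs
    obtain rfl : u = y := Fin.ext (hbu.symm.trans hby)
    have hji : j < i := by omega
    rw [upskill_C_of_ne _ hji.ne] at hu
    exact ⟨j, hj1, hji, ((h.subset_E_iff (h.past j hj1 hji)).1 hu).2⟩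
  · rintro ⟨j, hj1, hji, hC⟩
    refine ⟨_, ⟨j, ⟨hj1, by omega⟩, x, x.2, y, ⟨y.2, ?_⟩, rfl⟩, ?_⟩
    · intro hxy2
      exact hxy.ne (Fin.ext hxy2)
    · rw [sat_and, sat_and, sat_possible]
      simp only [Sat, h.upskill_C_self, key, hβ, Set.mem_singleton_iff, forall_eq,
        upskill_C_of_ne _ hji.ne, hC]
      simp

/-- `psi ∧ ¬ chi` says that agent `i` has received the skill of an edge at the current node which
has not been chosen before. -/
theorem sat_psi_and_not_chi (h : Position G M i H) {S : Set ℕ} (hS : S.Nonempty) {x : Fin n} :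
    (Sat (M.upskill i S) x (psi n i) ∧ ¬ Sat (M.upskill i S) x (chi n i)) ↔
      ∃ y, H.Adj x y ∧ S = {edgeSkill x y} := by
  rw [h.sat_psi hS]
  constructor
  · rintro ⟨⟨y, hxy, rfl⟩, h2⟩
    rw [h.sat_chi hxy] at h2
    refine ⟨y, (h.adj_iff _ _).2 ⟨hxy, fun j h1 h3 h4 => h2 ⟨j, h1, h3, h4⟩⟩, rfl⟩
  · rintro ⟨y, hxy, rfl⟩
    obtain ⟨h1, h2⟩ := (h.adj_iff _ _).1 hxy
    refine ⟨⟨y, h1, rfl⟩, ?_⟩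
    rw [h.sat_chi h1]
    rintro ⟨j, h3, h4, h5⟩
    exact h2 j h3 h4 h5

/-- Choosing the edge `{x, y}` in the `i`-th move gives agent `i` its skill. -/
theorem move (h : Position G M i H) (hi : 1 ≤ i) (x y : Fin n) :
    Position G (M.upskill i {edgeSkill x y}) (i + 1) (H.deleteEdges {s(x, y)}) where
  E_eq := h.E_eq
  β_eq := h.β_eq
  future j hj := by
    rw [upskill_C_of_ne _ (by omega)]
    exact h.future j (by omega)
  past j h1 h2 := by
    rcases eq_or_ne j i with rfl | hj
    · rw [h.upskill_C_self]
      exact Set.singleton_nonempty _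
    · rw [upskill_C_of_ne _ hj]
      exact h.past j h1 (by omega)
  adj_iff a b := by
    have hne : ({edgeSkill x y} : Set ℕ) ≠ {edgeSkill a b} ↔ s(a, b) ∉ ({s(x, y)} : Set _) := by
      rw [Ne, Set.singleton_eq_singleton_iff, edgeSkill_inj, Set.mem_singleton_iff, eq_comm]
    rw [SimpleGraph.deleteEdges_adj, h.adj_iff, and_assoc, ← hne]
    refine and_congr_right fun _ => ⟨?_, fun h1 => ⟨fun j h2 h3 => ?_, ?_⟩⟩
    · rintro ⟨h1, h2⟩ j h3 h4
      rcases eq_or_ne j i with rfl | hj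
      · rwa [h.upskill_C_self]
      · rw [upskill_C_of_ne _ hj]
        exact h1 j h3 (by omega)
    · have h4 := h1 j h2 (by omega)
      rwa [upskill_C_of_ne _ h3.ne] at h4
    · have h4 := h1 i hi (by omega)
      rwa [h.upskill_C_self] at h4

theorem sat_know (h : Position G M i H) {x y : Fin n} (hxy : G.Adj x y) {φ : Formula} :
    Sat (M.upskill i {edgeSkill x y}) x (.know i φ) ↔
      Sat (M.upskill i {edgeSkill x y}) y φ := by
  have key : ∀ u, {edgeSkill x y} ⊆ (M.upskill i {edgeSkill x y}).E x u ↔ u = y :=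
    fun u => h.singleton_subset_E_iff hxy
  simp only [Sat, h.upskill_C_self, key, forall_eq]

theorem sat_possible (h : Position G M i H) {x y : Fin n} (hxy : G.Adj x y) {φ : Formula} :
    Sat (M.upskill i {edgeSkill x y}) x (.possible i φ) ↔
      Sat (M.upskill i {edgeSkill x y}) y φ := by
  have := h.sat_know hxy (φ := φ.neg)
  rw [Formula.possible, sat_neg, this, sat_neg, not_not]

/-- The shape of the formula for a move of Player I: some edge that has not been chosen leads to a
node at which `φ` holds. -/
theorem sat_choice (h : Position G M i H) {x : Fin n} {φ : Formula} :
    Sat M x (.diamondplus i ((psi n i).and ((chi n i).neg.and (.know i φ)))) ↔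
      ∃ y, H.Adj x y ∧ Sat (M.upskill i {edgeSkill x y}) y φ := by
  rw [sat_diamondplus]
  simp only [sat_and, sat_neg]
  constructor
  · rintro ⟨S, hS, h0, h1, h2⟩
    replace h1 := And.intro h0 h1
    rw [h.sat_psi_and_not_chi (by simpa using hS)] at h1
    obtain ⟨y, hy, hSy⟩ := h1
    rw [hSy] at h2
    exact ⟨y, hy, (h.sat_know ((h.adj_iff _ _).1 hy).1).1 h2⟩
  · rintro ⟨y, hy, h2⟩
    refine ⟨{edgeSkill x y}, Finset.singleton_nonempty _, ?_⟩
    rw [Finset.coe_singleton, ← and_assoc, h.sat_psi_and_not_chi (Set.singleton_nonempty _),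
      h.sat_know ((h.adj_iff _ _).1 hy).1]
    exact ⟨⟨y, hy, rfl⟩, h2⟩

/-- The shape of the formula for the last move of Player II: there is no legal move. -/
theorem sat_answer_last (h : Position G M i H) {x : Fin n} :
    Sat M x (.boxplus i ((psi n i).neg.or (chi n i))) ↔ ∀ y, ¬ H.Adj x y := by
  simp only [Sat, sat_or]
  constructor
  · intro h1 y hy
    have h2 := (h.sat_psi_and_not_chi (Set.singleton_nonempty _)).2 ⟨y, hy, rfl⟩
    have h3 := h1 {edgeSkill x y} (Finset.singleton_nonempty _)
    rw [Finset.coe_singleton] at h3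
    tauto
  · intro h1 S hS
    by_contra h2
    push Not at h2
    obtain ⟨y, hy, -⟩ := (h.sat_psi_and_not_chi (by simpa using hS)).1 h2
    exact h1 y hy

/-- The shape of the formula for the other moves of Player II: every edge that has not been chosen
leads to a node at which `φ` holds. -/
theorem sat_answer (h : Position G M i H) {x : Fin n} {φ : Formula} :
    Sat M x (.boxplus i ((psi n i).neg.or ((chi n i).or (.possible i φ)))) ↔
      ∀ y, H.Adj x y → Sat (M.upskill i {edgeSkill x y}) y φ := by
  simp only [Sat, sat_or]
  constructor
  · intro h1 y hy
    have h2 := (h.sat_psi_and_not_chi (Set.singleton_nonempty _)).2 ⟨y, hy, rfl⟩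
    have h3 := h1 {edgeSkill x y} (Finset.singleton_nonempty _)
    rw [Finset.coe_singleton] at h3
    rw [← h.sat_possible ((h.adj_iff _ _).1 hy).1]
    tauto
  · intro h1 S hS
    by_cases h2 : Sat (M.upskill i S) x (psi n i) ∧ ¬ Sat (M.upskill i S) x (chi n i)
    · obtain ⟨y, hy, hSy⟩ := (h.sat_psi_and_not_chi (by simpa using hS)).1 h2
      right
      right
      rw [hSy, h.sat_possible ((h.adj_iff _ _).1 hy).1]
      exact h1 y hy
    · tauto

/-- The rounds of the formula that remain suffice for all the edges that remain, so that the bounded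
unfolding of the game is the game itself. -/
theorem sat_phiFrom {r : ℕ} (h : Position G M i H) (hH : H.edgeSet.ncard ≤ 2 * (r + 1))
    (hi : 1 ≤ i) (x : Fin n) : Sat M x (phiFrom n r i) ↔ FirstPlayerWins H x := by
  induction r generalizing M i H x with
  | zero =>
    rw [phiFrom, h.sat_choice, firstPlayerWins_iff]
    refine exists_congr fun y => and_congr_right fun hy => ?_
    rw [(h.move hi x y).sat_answer_last]
    refine forall_congr' fun z => ?_
    refine ⟨fun h1 h2 => absurd h2 h1, fun h1 hz => ?_⟩
    obtain ⟨w, hw, -⟩ := firstPlayerWins_iff.1 (h1 hz)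
    -- At most two edges are left, so Player I has no move after an answer of Player II.
    have l1 := ncard_deleteEdges_lt hy
    have l2 := ncard_deleteEdges_lt hz
    have l3 := ncard_deleteEdges_lt hw
    omega
  | succ r ih =>
    rw [phiFrom, h.sat_choice, firstPlayerWins_iff]
    refine exists_congr fun y => and_congr_right fun hy => ?_
    rw [(h.move hi x y).sat_answer]
    refine forall_congr' fun z => imp_congr_right fun hz => ?_
    have l1 := ncard_deleteEdges_lt hy
    have l2 := ncard_deleteEdges_lt hz
    exact ih ((h.move hi x y).move (by omega) y z) (by omega) (by omega) z

end Position

open Classical in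
theorem uEG_iff_modelChecking (g : RootedGraph) :
    UEG g ↔ ModelChecking (inducedInstance g) := by
  have h : Position g.graph (inducedModel g).toModel 1 g.graph := by
    refine ⟨fun x y => ?_, fun x => ?_, fun j _ => ?_, fun j h1 h2 => ?_, fun x y => ?_⟩
    · change ((if g.graph.Adj x y then {edgeSkill x y} else ∅ : Finset ℕ) : Set ℕ) = _
      split_ifs <;> simp
    · change (({(x : ℕ)} : Finset ℕ) : Set ℕ) = _
      simp
    · change ((∅ : Finset ℕ) : Set ℕ) = _
      simp
    · omega
    · refine ⟨fun h => ⟨h, fun j h1 h2 => ?_⟩, fun h => h.1⟩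
      omega
  refine (h.sat_phiFrom (r := numAgents g / 2 - 1) ?_ le_rfl g.root).symm
  change g.edges ≤ _
  unfold numAgents
  omega

/-! ### The size of the induced model and the length of the induced formula -/

theorem numAgents_le (g : RootedGraph) : numAgents g ≤ g.edges + 2 := by
  unfold numAgents
  omega

theorem size_inducedModel_le (g : RootedGraph) :
    (inducedModel g).size ≤ 10 * g.nodes ^ 2 + 9 * g.nodes + 6 * numAgents g + 3 := by
  classical
  have hE : ∀ w u : Fin g.nodes, setSymbols ((inducedModel g).E w u) + 7 ≤ 10 := by
    intro w u
    change setSymbols (if g.graph.Adj w u then {edgeSkill w u} else ∅) + 7 ≤ 10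
    split_ifs <;> simp [setSymbols]
  have h1 : ∑ w : Fin g.nodes, ∑ u : Fin g.nodes, (setSymbols ((inducedModel g).E w u) + 7) ≤
      10 * g.nodes ^ 2 := by
    refine (Finset.sum_le_sum fun w _ => Finset.sum_le_sum fun u _ => hE w u).trans ?_
    simp only [Finset.sum_const, Finset.card_univ, Fintype.card_fin, smul_eq_mul]
    exact le_of_eq (by ring)
  have h2 : ∑ a ∈ (inducedModel g).agents, (setSymbols ((inducedModel g).C a) + 5) =
      6 * numAgents g := by
    change ∑ a ∈ Finset.Icc 1 (numAgents g), (setSymbols ∅ + 5) = _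
    simp [setSymbols, mul_comm]
  have h3 : ∑ w : Fin g.nodes, (setSymbols ((inducedModel g).β w) + 5) = 8 * g.nodes := by
    change ∑ w : Fin g.nodes, (setSymbols {(w : ℕ)} + 5) = _
    simp [setSymbols, mul_comm]
  have h4 : (inducedModel g).size = g.nodes
      + (1 + ∑ w : Fin g.nodes, ∑ u : Fin g.nodes, (setSymbols ((inducedModel g).E w u) + 7))
      + (1 + ∑ a ∈ (inducedModel g).agents, (setSymbols ((inducedModel g).C a) + 5))
      + (1 + ∑ w : Fin g.nodes, (setSymbols ((inducedModel g).β w) + 5)) := rfl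
  omega

theorem length_bigOr_le {l : List Formula} {L : ℕ} (h : ∀ φ ∈ l, φ.length ≤ L) :
    (Formula.bigOr l).length ≤ l.length * (L + 4) + 6 := by
  induction l with
  | nil => simp [Formula.bigOr, Formula.bot, Formula.length]
  | cons a l ih =>
    have h1 := h a (by simp)
    have h2 := ih fun φ hφ => h φ (by simp [hφ])
    change a.length + 1 + (Formula.bigOr l).length + 3 ≤ (l.length + 1) * (L + 4) + 6
    linarith

theorem length_psi_le (D i : ℕ) : (psi D i).length ≤ 7 * D + 20 := by
  have h := length_bigOr_le (l := (List.range D).map fun x => .know i (.atom x)) (L := 3)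
    (by simp [Formula.length])
  simp only [List.length_map, List.length_range] at h
  simp only [psi, Formula.and, Formula.bot, Formula.length]
  omega

theorem length_chi_le {D i N : ℕ} (hi : i ≤ N + 1) : (chi D i).length ≤ 23 * (N * D ^ 2) + 6 := by
  refine (length_bigOr_le (L := 19) ?_).trans ?_
  · intro φ hφ
    obtain ⟨j, -, hφ⟩ := List.mem_flatMap.1 hφ
    obtain ⟨x, -, hφ⟩ := List.mem_flatMap.1 hφ
    obtain ⟨y, -, rfl⟩ := List.mem_map.1 hφ
    simp [Formula.and, Formula.possible, Formula.length]
  · have key : ∀ (l : List ℕ) (f : ℕ → List Formula) (B : ℕ), (∀ x, (f x).length ≤ B) →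
        (l.flatMap f).length ≤ l.length * B := by
      intro l f B hf
      induction l with
      | nil => simp
      | cons a l ih =>
        rw [List.flatMap_cons, List.length_append, List.length_cons, add_mul, one_mul, add_comm]
        exact Nat.add_le_add ih (hf a)
    have h1 := key (List.range' 1 (i - 1)) (fun (j : ℕ) =>
      (List.range D).flatMap fun (x : ℕ) =>
        ((List.range D).filter (fun y => x ≠ y)).map fun (y : ℕ) =>
          (Formula.atom x).and ((Formula.possible j (.atom y)).and (.know i (.atom y))))
      (D * D) (fun j => by
        refine (key (List.range D) _ D fun x => ?_).trans ?_
        · rw [List.length_map]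
          exact (List.length_filter_le _ _).trans (by simp)
        · simp)
    rw [List.length_range'] at h1
    have h2 : (i - 1) * (D * D) ≤ N * D ^ 2 := by
      rw [sq]
      exact Nat.mul_le_mul_right _ (by omega)
    omega

theorem length_phiFrom_le {D r i N : ℕ} (h : i + 2 * r ≤ N) :
    (phiFrom D r i).length ≤ (r + 1) * (46 * (N * D ^ 2) + 14 * D + 90) := by
  have p1 := length_psi_le D i
  have p2 := length_psi_le D (i + 1)
  have c1 := length_chi_le (D := D) (i := i) (N := N) (by omega)
  have c2 := length_chi_le (D := D) (i := i + 1) (N := N) (by omega)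
  induction r generalizing i with
  | zero =>
    simp only [phiFrom, Formula.diamondplus, Formula.and, Formula.or, Formula.length]
    omega
  | succ r ih =>
    have h1 := ih (i := i + 2) (by omega) (length_psi_le _ _) (length_psi_le _ _)
      (length_chi_le (by omega)) (length_chi_le (by omega))
    simp only [phiFrom, Formula.diamondplus, Formula.possible, Formula.and, Formula.or,
      Formula.length]
    rw [add_mul (r + 1), one_mul]
    omega

theorem exists_polynomial_bound : ∃ p : Polynomial ℕ, ∀ g : RootedGraph,
    (inducedModel g).size ≤ p.eval (g.nodes + g.edges) ∧
    (inducedFormula g).length ≤ p.eval (g.nodes + g.edges) := by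
  refine ⟨(Polynomial.X + 2) * (46 * ((Polynomial.X + 2) * Polynomial.X ^ 2) +
    14 * Polynomial.X + 90), fun g => ?_⟩
  have hs := size_inducedModel_le g
  have hN := numAgents_le g
  have hl : (inducedFormula g).length ≤ _ := length_phiFrom_le (D := g.nodes) (i := 1)
    (r := numAgents g / 2 - 1) (N := numAgents g) (by unfold numAgents; omega)
  have hr : numAgents g / 2 - 1 + 1 ≤ g.edges + 2 := by unfold numAgents; omega
  have e : ∀ m : ℕ, ((Polynomial.X + 2) * (46 * ((Polynomial.X + 2) * Polynomial.X ^ 2) +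
      14 * Polynomial.X + 90) : Polynomial ℕ).eval m
      = (m + 2) * (46 * ((m + 2) * m ^ 2) + 14 * m + 90) := by
    intro m
    simp
  rw [e]
  set m := g.nodes + g.edges with hm
  have hD : g.nodes ≤ m := by omega
  have hNm : numAgents g ≤ m + 2 := by omega
  constructor
  · refine hs.trans ?_
    have : g.nodes ^ 2 ≤ m ^ 2 := Nat.pow_le_pow_left hD 2
    nlinarith [Nat.zero_le (m ^ 3), Nat.zero_le (m ^ 4)]
  · refine hl.trans ?_
    have h1 : numAgents g * g.nodes ^ 2 ≤ (m + 2) * m ^ 2 :=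
      Nat.mul_le_mul hNm (Nat.pow_le_pow_left hD 2)
    exact Nat.mul_le_mul (by omega) (by omega)

open Turing

/-! ### Structured programs -/

/-- The counters. The counters `tmp` and `acc` are scratch space; `nodes`, `root` and `rounds` hold
the number of nodes, the root, and the number of rounds after the first; the others are loop
variables. -/
inductive Ctr : Type
  | tmp | acc | nodes | root | rounds | round | agent | fst | snd | tick
  deriving DecidableEq

instance : Fintype Ctr where
  elems := {.tmp, .acc, .nodes, .root, .rounds, .round, .agent, .fst, .snd, .tick}
  complete c := by cases c <;> decide

/-- The memory: the input stack, a second stack of bits, the output stack, and the counters. The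
head of a list is the top of the stack. -/
structure Memory where
  inp : List Bool
  aux : List Bool
  out : List Token
  ctr : Ctr → ℕ

/-- Elementary instructions. -/
inductive Instr : Type
  | nop
  | inc (v : Ctr)
  | dec (v : Ctr)
  | emit (t : Token)
  /-- remove the top of the input stack -/
  | drop
  /-- move the top of the input stack to the auxiliary stack -/
  | shift
  /-- move the top of the auxiliary stack back to the input stack -/
  | unshift

/-- The effect of an instruction on the memory; nothing happens if it needs the top of an empty
stack. -/
def Instr.run : Instr → Memory → Memory
  | nop, s => s
  | inc v, s => { s with ctr := Function.update s.ctr v (s.ctr v + 1) }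
  | dec v, s => { s with ctr := Function.update s.ctr v (s.ctr v - 1) }
  | emit t, s => { s with out := t :: s.out }
  | drop, s => { s with inp := s.inp.tail }
  | shift, s => { s with inp := s.inp.tail, aux := s.inp.head?.toList ++ s.aux }
  | unshift, s => { s with inp := s.aux.head?.toList ++ s.inp, aux := s.aux.tail }

/-- Tests: a counter is positive, the top of the input stack is `true`, the input stack is
nonempty, the auxiliary stack is nonempty. -/
inductive Test : Type
  | pos (v : Ctr)
  | bit
  | more
  | auxMore

/-- The value of a test. -/
def Test.holds : Test → Memory → Bool
  | pos v, s => decide (0 < s.ctr v)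
  | bit, s => s.inp.head? == some true
  | more, s => s.inp.head?.isSome
  | auxMore, s => s.aux.head?.isSome

/-- Structured programs. -/
inductive Prog : Type
  | act (a : Instr) : Prog
  | seq (p q : Prog) : Prog
  | ite (c : Test) (p q : Prog) : Prog
  | while (c : Test) (p : Prog) : Prog

/-- `Runs p s s' k`: the program `p` leads from the memory `s` to `s'` in `k` steps, where every
instruction and every test is one step. -/
inductive Runs : Prog → Memory → Memory → ℕ → Prop
  | act (a : Instr) (s : Memory) : Runs (.act a) s (a.run s) 1
  | seq {p q : Prog} {s s' s'' : Memory} {k l : ℕ} (h : Runs p s s' k) (h' : Runs q s' s'' l) :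
      Runs (.seq p q) s s'' (k + l)
  | ite_true {c : Test} {p q : Prog} {s s' : Memory} {k : ℕ} (hc : c.holds s = true)
      (h : Runs p s s' k) : Runs (.ite c p q) s s' (k + 1)
  | ite_false {c : Test} {p q : Prog} {s s' : Memory} {k : ℕ} (hc : c.holds s = false)
      (h : Runs q s s' k) : Runs (.ite c p q) s s' (k + 1)
  | while_false {c : Test} {p : Prog} {s : Memory} (hc : c.holds s = false) :
      Runs (.while c p) s s 1
  | while_true {c : Test} {p : Prog} {s s' s'' : Memory} {k l : ℕ} (hc : c.holds s = true)
      (h : Runs p s s' k) (h' : Runs (.while c p) s' s'' l) :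
      Runs (.while c p) s s'' (k + 1 + l)

/-! ### Structured programs as Turing machines -/

/-- The stacks of the machine. -/
inductive Stack : Type
  | inp | aux | out
  | ctr (v : Ctr)
  deriving DecidableEq

instance : Fintype Stack where
  elems := {.inp, .aux, .out} ∪ Finset.univ.map ⟨Stack.ctr, fun _ _ h => Stack.ctr.inj h⟩
  complete k := by
    cases k with
    | ctr v => exact Finset.mem_union_right _ (Finset.mem_map_of_mem _ (Finset.mem_univ v))
    | _ => simp

/-- The stack alphabets; a counter is a stack over a one-letter alphabet. -/
def Stack.Alphabet : Stack → Type
  | inp => Bool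
  | aux => Bool
  | out => Token
  | ctr _ => Unit

/-- The stack contents that represent a memory. -/
def Memory.stk (s : Memory) : (k : Stack) → List k.Alphabet
  | .inp => s.inp
  | .aux => s.aux
  | .out => s.out
  | .ctr v => List.replicate (s.ctr v) ()

/-- A statement that carries out an instruction and goes on with `q`. The internal state, which is
`none` between the steps, remembers a bit that is on its way from one stack to another. -/
def Instr.toStmt {Λ : Type} (a : Instr) (q : TM2.Stmt Stack.Alphabet Λ (Option Bool)) :
    TM2.Stmt Stack.Alphabet Λ (Option Bool) :=
  match a with
  | nop => q
  | inc v => .push (Stack.ctr v) (fun _ => ()) q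
  | dec v => .pop (Stack.ctr v) (fun σ _ => σ) q
  | emit t => .push Stack.out (fun _ => t) q
  | drop => .pop Stack.inp (fun σ _ => σ) q
  | shift => .pop Stack.inp (fun _ (o : Option Bool) => o)
      (.branch Option.isSome
        (.push Stack.aux (fun σ => (σ.getD false : Bool)) (.load (fun _ => none) q)) q)
  | unshift => .pop Stack.aux (fun _ (o : Option Bool) => o)
      (.branch Option.isSome
        (.push Stack.inp (fun σ => (σ.getD false : Bool)) (.load (fun _ => none) q)) q)

/-- A statement that branches according to a test. -/
def Test.toStmt {Λ : Type} (c : Test) (q₁ q₂ : TM2.Stmt Stack.Alphabet Λ (Option Bool)) :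
    TM2.Stmt Stack.Alphabet Λ (Option Bool) :=
  let fork := TM2.Stmt.branch (fun σ : Option Bool => σ == some true)
    (.load (fun _ => none) q₁) (.load (fun _ => none) q₂)
  match c with
  | pos v => .peek (Stack.ctr v) (fun _ o => some o.isSome) fork
  | bit => .peek Stack.inp (fun _ (o : Option Bool) => some (o == some true)) fork
  | more => .peek Stack.inp (fun _ o => some o.isSome) fork
  | auxMore => .peek Stack.aux (fun _ o => some o.isSome) fork

theorem stepAux_instr {Λ : Type} (a : Instr) (q : TM2.Stmt Stack.Alphabet Λ (Option Bool))
    (s : Memory) :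
    TM2.stepAux (a.toStmt q) none s.stk = TM2.stepAux q none (a.run s).stk := by
  obtain ⟨inp, aux, out, ctr⟩ := s
  have key : ∀ {S S' : (k : Stack) → List k.Alphabet}, (∀ k, S k = S' k) →
      TM2.stepAux q none S = TM2.stepAux q none S' := fun h => by rw [funext h]
  cases a with
  | nop => rfl
  | inc v =>
    refine key fun k => ?_
    cases k with
    | ctr w =>
      rcases eq_or_ne w v with rfl | hw
      · simp only [Memory.stk, Instr.run, Function.update_self]
        rfl
      · simp [Memory.stk, Instr.run, hw]
    | _ => rfl
  | dec v =>
    refine key fun k => ?_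
    cases k with
    | ctr w =>
      rcases eq_or_ne w v with rfl | hw
      · simp only [Memory.stk, Instr.run, Function.update_self]
        exact List.tail_replicate
      · simp [Memory.stk, Instr.run, hw]
    | _ => rfl
  | emit t => exact key fun k => by cases k <;> rfl
  | drop => exact key fun k => by cases k <;> rfl
  | shift => cases inp <;> exact key fun k => by cases k <;> rfl
  | unshift => cases aux <;> exact key fun k => by cases k <;> rfl

theorem stepAux_test {Λ : Type} (c : Test) (q₁ q₂ : TM2.Stmt Stack.Alphabet Λ (Option Bool))
    (s : Memory) :
    TM2.stepAux (c.toStmt q₁ q₂) none s.stk =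
      if c.holds s then TM2.stepAux q₁ none s.stk else TM2.stepAux q₂ none s.stk := by
  obtain ⟨inp, aux, out, ctr⟩ := s
  cases c with
  | pos v =>
    cases h : ctr v with
    | zero => simp [Test.toStmt, Test.holds, Memory.stk, h]
    | succ m =>
      simp only [Test.toStmt, Test.holds, Memory.stk, TM2.stepAux, h]
      rfl
  | bit =>
    rcases inp with - | ⟨_ | _, _⟩ <;> rfl
  | more => cases inp <;> rfl
  | auxMore => cases aux <;> rfl

/-- The labels of the machine for a program: one for each instruction and each test in it. -/
def Prog.Label : Prog → Type
  | act _ => Unit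
  | seq p q => p.Label ⊕ q.Label
  | ite _ p q => Option (p.Label ⊕ q.Label)
  | .while _ p => Option p.Label

/-- There are finitely many labels. -/
instance Prog.fintypeLabel : (p : Prog) → Fintype p.Label
  | act _ => inferInstanceAs (Fintype Unit)
  | seq p q =>
    have := p.fintypeLabel
    have := q.fintypeLabel
    inferInstanceAs (Fintype (p.Label ⊕ q.Label))
  | ite _ p q =>
    have := p.fintypeLabel
    have := q.fintypeLabel
    inferInstanceAs (Fintype (Option (p.Label ⊕ q.Label)))
  | .while _ p =>
    have := p.fintypeLabel
    inferInstanceAs (Fintype (Option p.Label))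

/-- The label at which a program starts. -/
def Prog.entry : (p : Prog) → p.Label
  | act _ => ()
  | seq p _ => Sum.inl p.entry
  | ite _ _ _ => none
  | .while _ _ => none

/-- Go to a label, or halt. -/
def jump {Λ : Type} : Option Λ → TM2.Stmt Stack.Alphabet Λ (Option Bool)
  | none => .halt
  | some l => .goto fun _ => l

/-- The statements of a program whose labels are renamed by `f`, and which goes to `e` when it has
finished. -/
def Prog.code {Λ : Type} : (p : Prog) → (p.Label → Λ) → Option Λ → p.Label →
    TM2.Stmt Stack.Alphabet Λ (Option Bool)
  | act a, _, e, _ => a.toStmt (jump e)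
  | seq p q, f, e, l =>
    match l with
    | Sum.inl l => p.code (fun l => f (Sum.inl l)) (some (f (Sum.inr q.entry))) l
    | Sum.inr l => q.code (fun l => f (Sum.inr l)) e l
  | ite c p q, f, e, l =>
    match l with
    | none => c.toStmt (jump (some (f (some (Sum.inl p.entry)))))
        (jump (some (f (some (Sum.inr q.entry)))))
    | some (Sum.inl l) => p.code (fun l => f (some (Sum.inl l))) e l
    | some (Sum.inr l) => q.code (fun l => f (some (Sum.inr l))) e l
  | .while c p, f, e, l =>
    match l with
    | none => c.toStmt (jump (some (f (some p.entry)))) (jump e)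
    | some l => p.code (fun l => f (some l)) (some (f none)) l

theorem stepAux_jump {Λ : Type} (e : Option Λ) (S : (k : Stack) → List k.Alphabet) :
    TM2.stepAux (jump e) none S = ⟨e, none, S⟩ := by
  cases e <;> rfl

/-- The machine code of `p` simulates `p` step by step. -/
theorem Runs.iterate_step {Λ : Type} (M : Λ → TM2.Stmt Stack.Alphabet Λ (Option Bool)) {p : Prog}
    {s s' : Memory} {k : ℕ} (h : Runs p s s' k) (f : p.Label → Λ) (e : Option Λ)
    (hM : ∀ l, M (f l) = p.code f e l) :
    (flip bind (TM2.step M))^[k] (some ⟨some (f p.entry), none, s.stk⟩) =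
      some ⟨e, none, s'.stk⟩ := by
  have step : ∀ (l : Λ) (S : (k : Stack) → List k.Alphabet),
      flip bind (TM2.step M) (some ⟨some l, none, S⟩) = some (TM2.stepAux (M l) none S) :=
    fun _ _ => rfl
  induction h generalizing e with
  | act a s =>
    rw [Function.iterate_one, step, hM]
    change some (TM2.stepAux (a.toStmt (jump e)) none s.stk) = _
    rw [stepAux_instr, stepAux_jump]
  | seq _ _ ih ih' =>
    rw [Nat.add_comm, Function.iterate_add_apply]
    erw [ih (fun l => f (Sum.inl l)) _ fun l => hM (Sum.inl l)]
    exact ih' (fun l => f (Sum.inr l)) _ fun l => hM (Sum.inr l)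
  | ite_true hc _ ih =>
    rw [Function.iterate_succ_apply, step, hM]
    erw [stepAux_test]
    rw [if_pos hc, stepAux_jump]
    exact ih (fun l => f (some (Sum.inl l))) _ fun l => hM (some (Sum.inl l))
  | ite_false hc _ ih =>
    rw [Function.iterate_succ_apply, step, hM]
    erw [stepAux_test]
    rw [if_neg (by simp [hc]), stepAux_jump]
    exact ih (fun l => f (some (Sum.inr l))) _ fun l => hM (some (Sum.inr l))
  | while_false hc =>
    rw [Function.iterate_one, step, hM]
    erw [stepAux_test]
    rw [if_neg (by simp [hc]), stepAux_jump]
  | while_true hc _ _ ih ih' =>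
    rw [Nat.add_comm, Function.iterate_add_apply, Function.iterate_succ_apply, step, hM]
    erw [stepAux_test]
    rw [if_pos hc, stepAux_jump]
    erw [ih (fun l => f (some l)) _ fun l => hM (some l)]
    exact ih' f e hM

/-- The machine for a program, with `inp` as its input stack and `out` as its output stack. All its
alphabets, and not just that of the input, are finite. -/
def Prog.machine (p : Prog) : FinTM2 where
  K := Stack
  k₀ := .inp
  k₁ := .out
  Γ := Stack.Alphabet
  Λ := p.Label
  main := p.entry
  σ := Option Bool
  initialState := none
  Γk₀Fin := inferInstanceAs (Fintype Bool)
  m := p.code id none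

theorem Prog.initList_machine (p : Prog) (l : List Bool) :
    initList p.machine l = ⟨some p.entry, none, Memory.stk ⟨l, [], [], fun _ => 0⟩⟩ :=
  congrArg (TM2.Cfg.mk _ _) (funext fun k => by cases k <;> rfl)

theorem Prog.haltList_machine (p : Prog) (l : List Token) :
    haltList p.machine l = ⟨none, none, Memory.stk ⟨[], [], l, fun _ => 0⟩⟩ :=
  congrArg (TM2.Cfg.mk _ _) (funext fun k => by cases k <;> rfl)

/-- A program that turns the input word `ea a` into the output word `eb (f a)`, with all other
stacks empty at the end, shows that `f` is computable in polynomial time. -/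
theorem Prog.computableInPolyTime {α β : Type} {ea : α → List Bool} {eb : β → List Token}
    {f : α → β} (p : Prog) (T : Polynomial ℕ)
    (h : ∀ a, ∃ k ≤ T.eval (ea a).length,
      Runs p ⟨ea a, [], [], fun _ => 0⟩ ⟨[], [], eb (f a), fun _ => 0⟩ k) :
    Nonempty (TM2ComputableInPolyTime ea eb f) := by
  choose k hk hr using h
  refine ⟨{
    tm := p.machine
    inputAlphabet := Equiv.refl Bool
    outputAlphabet := Equiv.refl Token
    time := T
    outputsFun := fun a =>
      { steps := k a
        evals_in_steps := ?_
        steps_le_m := hk a } }⟩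
  have h1 := (hr a).iterate_step (p.code id none) id none fun _ => rfl
  have e1 : initList p.machine (List.map (Equiv.refl Bool).invFun (ea a)) = _ :=
    (congrArg (initList p.machine) (List.map_id (ea a))).trans (p.initList_machine (ea a))
  have e2 : haltList p.machine (List.map (Equiv.refl Token).invFun (eb (f a))) = _ :=
    (congrArg (haltList p.machine) (List.map_id (eb (f a)))).trans
      (p.haltList_machine (eb (f a)))
  rw [Option.map_some]
  erw [e1, e2]
  exact h1

/-! ### Running times of programs -/

/-- `p` leads from `s` to `s'` in at most `T` steps. -/
def Takes (p : Prog) (s s' : Memory) (T : ℕ) : Prop := ∃ k ≤ T, Runs p s s' k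

namespace Takes

variable {p q : Prog} {c : Test} {s s' s'' : Memory} {T T' : ℕ}

theorem mono (h : Takes p s s' T) (hT : T ≤ T') : Takes p s s' T' :=
  let ⟨k, hk, hr⟩ := h
  ⟨k, hk.trans hT, hr⟩

theorem act (a : Instr) (s : Memory) : Takes (.act a) s (a.run s) 1 := ⟨1, le_rfl, .act a s⟩

theorem seq (h : Takes p s s' T) (h' : Takes q s' s'' T') : Takes (.seq p q) s s'' (T + T') :=
  let ⟨k, hk, hr⟩ := h
  let ⟨l, hl, hr'⟩ := h'
  ⟨k + l, Nat.add_le_add hk hl, .seq hr hr'⟩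

theorem ite_true (hc : c.holds s = true) (h : Takes p s s' T) :
    Takes (.ite c p q) s s' (T + 1) :=
  let ⟨k, hk, hr⟩ := h
  ⟨k + 1, Nat.add_le_add_right hk 1, .ite_true hc hr⟩

theorem ite_false (hc : c.holds s = false) (h : Takes q s s' T) :
    Takes (.ite c p q) s s' (T + 1) :=
  let ⟨k, hk, hr⟩ := h
  ⟨k + 1, Nat.add_le_add_right hk 1, .ite_false hc hr⟩

/-- A loop that runs through the memories `F n, F (n - 1), …, F 0`. -/
theorem loop (F : ℕ → Memory) (n : ℕ) (h₀ : c.holds (F 0) = false)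
    (h₁ : ∀ k < n, c.holds (F (k + 1)) = true) (h : ∀ k < n, Takes p (F (k + 1)) (F k) T) :
    Takes (.while c p) (F n) (F 0) (n * (T + 1) + 1) := by
  induction n with
  | zero => exact ⟨1, by omega, .while_false h₀⟩
  | succ n ih =>
    obtain ⟨k, hk, hr⟩ := h n n.lt_succ_self
    obtain ⟨l, hl, hr'⟩ := ih (fun k hk => h₁ k (by omega)) fun k hk => h k (by omega)
    exact ⟨k + 1 + l, by rw [add_mul]; omega, .while_true (h₁ n n.lt_succ_self) hr hr'⟩

end Takes

namespace Memory

/-- Set a counter. -/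
def set (s : Memory) (v : Ctr) (n : ℕ) : Memory := { s with ctr := Function.update s.ctr v n }

/-- Write a word onto the output stack, from its last letter to its first. -/
def write (s : Memory) (l : List Token) : Memory := { s with out := l ++ s.out }

variable (s : Memory) (v w : Ctr) (m n : ℕ)

@[simp] theorem set_ctr_self : (s.set v n).ctr v = n := Function.update_self ..

@[simp] theorem set_inp : (s.set v n).inp = s.inp := rfl

@[simp] theorem write_ctr (l : List Token) : (s.write l).ctr = s.ctr := rfl

theorem write_set (l : List Token) : (s.write l).set v n = (s.set v n).write l := rfl

@[simp] theorem write_nil : s.write [] = s := rfl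

theorem write_write (l l' : List Token) : (s.write l).write l' = s.write (l' ++ l) := by
  simp [write]

variable {v w}

theorem set_ctr_of_ne (h : w ≠ v) : (s.set v n).ctr w = s.ctr w := Function.update_of_ne h ..

@[simp] theorem set_set : (s.set v m).set v n = s.set v n := by
  simp [set]

theorem set_comm (h : v ≠ w) : (s.set v m).set w n = (s.set w n).set v m := by
  simp [set, Function.update_comm h]

variable {s n}

theorem set_eq_self (h : s.ctr v = n) : s.set v n = s := by
  subst h
  simp [set]

end Memory

theorem Takes.inc (s : Memory) (v : Ctr) : Takes (.act (.inc v)) s (s.set v (s.ctr v + 1)) 1 :=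
  .act _ s

theorem Takes.dec (s : Memory) (v : Ctr) : Takes (.act (.dec v)) s (s.set v (s.ctr v - 1)) 1 :=
  .act _ s

/-! ### Program macros -/

namespace Prog

/-- Carry out `p` once for each unit of the counter `x`, which is preserved; `u` is scratch
space. -/
def forEach (x u : Ctr) (p : Prog) : Prog :=
  .seq (.while (.pos x) (.seq (.act (.dec x)) (.seq (.act (.inc u)) p)))
    (.while (.pos u) (.seq (.act (.dec u)) (.act (.inc x))))

/-- Set a counter to `0`. -/
def clear (x : Ctr) : Prog := .while (.pos x) (.act (.dec x))

/-- Add to the counter `v` the counters of the list `e` and the constant `c`. -/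
def addTo (v : Ctr) (e : List Ctr) (c : ℕ) : Prog :=
  match e with
  | [] => Nat.rec (.act .nop) (fun _ p => .seq p (.act (.inc v))) c
  | x :: e => .seq (forEach x .tmp (.act (.inc v))) (addTo v e c)

/-- Write a word onto the output stack. -/
def writeWord : List Token → Prog
  | [] => .act .nop
  | t :: l => .seq (writeWord l) (.act (.emit t))

end Prog

/-- If the `m`-th execution of `p` leads from `G m` to `G (m + 1)` whatever the values of `x` and `u`,
then `forEach` leads from `G 0` to `G n`, where `n` is the value of `x`. -/
theorem takes_forEach {x u : Ctr} {p : Prog} {n T : ℕ} (G : ℕ → Memory) (hxu : x ≠ u)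
    (hx₀ : (G 0).ctr x = n) (hu₀ : (G 0).ctr u = 0) (hx : (G n).ctr x = n) (hu : (G n).ctr u = 0)
    (h : ∀ m < n, ∀ i k, Takes p (((G m).set x i).set u k) (((G (m + 1)).set x i).set u k) T) :
    Takes (.forEach x u p) (G 0) (G n) (n * (T + 6) + 2) := by
  have h1 := Takes.loop (c := .pos x) (p := .seq (.act (.dec x)) (.seq (.act (.inc u)) p))
    (T := T + 2) (fun i => ((G (n - i)).set x i).set u (n - i)) n
    (by simp [Test.holds, Memory.set_ctr_of_ne _ _ hxu])
    (fun k _ => by simp [Test.holds, Memory.set_ctr_of_ne _ _ hxu])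
    (fun k hk => by
      refine ((Takes.dec _ _).seq ((Takes.inc _ _).seq ?_)).mono (by omega : 1 + (1 + T) ≤ T + 2)
      have e1 : n - k = (n - (k + 1)) + 1 := by omega
      have h2 := h (n - (k + 1)) (by omega) k (n - k)
      rw [← e1] at h2
      convert h2 using 1
      rw [Memory.set_ctr_of_ne _ _ hxu, Memory.set_ctr_of_ne _ _ hxu.symm,
        Memory.set_comm _ _ _ hxu.symm, Memory.set_set, Memory.set_ctr_self, Memory.set_ctr_self,
        Memory.set_set, ← e1]
      rfl)
  have h2 := Takes.loop (c := .pos u) (p := .seq (.act (.dec u)) (.act (.inc x)))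
    (T := 2) (fun i => ((G n).set x (n - i)).set u i) n
    (by simp [Test.holds]) (fun k _ => by simp [Test.holds])
    (fun k hk => by
      have h3 := (Takes.dec (((G n).set x (n - (k + 1))).set u (k + 1)) u).seq (Takes.inc _ x)
      convert h3 using 1
      have e1 : n - k = (n - (k + 1)) + 1 := by omega
      rw [Memory.set_set, Memory.set_ctr_self, Memory.set_ctr_of_ne _ _ hxu, Memory.set_ctr_self,
        Memory.set_comm _ _ _ hxu.symm, Memory.set_set, ← e1]
      rfl)
  simp only [Nat.sub_self, Nat.sub_zero] at h1 h2
  rw [Memory.set_eq_self hx₀, Memory.set_eq_self hu₀] at h1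
  rw [Memory.set_eq_self hx, Memory.set_eq_self hu] at h2
  exact (h1.seq h2).mono (by ring_nf; omega)

theorem takes_clear (x : Ctr) (s : Memory) :
    Takes (.clear x) s (s.set x 0) (2 * s.ctr x + 1) := by
  have h := Takes.loop (c := .pos x) (p := .act (.dec x)) (T := 1) (fun i => s.set x i) (s.ctr x)
    (by simp [Test.holds]) (fun k _ => by simp [Test.holds])
    (fun k _ => by
      have h1 := Takes.dec (s.set x (k + 1)) x
      simpa using h1)
  rw [Memory.set_eq_self rfl] at h
  exact h.mono (by omega)

theorem takes_addTo {v : Ctr} {e : List Ctr} {c : ℕ} {s : Memory} {B : ℕ} (hv : v ≠ .tmp)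
    (he : v ∉ e) (ht : .tmp ∉ e) (hs : s.ctr .tmp = 0) (hB : ∀ x ∈ e, s.ctr x ≤ B) :
    Takes (.addTo v e c) s (s.set v (s.ctr v + ((e.map s.ctr).sum + c)))
      (e.length * (7 * B + 2) + c + 1) := by
  induction e generalizing s with
  | nil =>
    simp only [Prog.addTo, List.map_nil, List.sum_nil, List.length_nil, zero_mul, zero_add]
    induction c with
    | zero =>
      rw [Nat.add_zero, Memory.set_eq_self rfl]
      exact Takes.act .nop s
    | succ c ih =>
      have h := ih.seq (Takes.inc _ v)
      rwa [Memory.set_ctr_self, Memory.set_set, add_assoc] at h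
  | cons x e ih =>
    simp only [List.mem_cons, not_or] at he ht
    have h1 := takes_forEach (x := x) (u := .tmp) (p := .act (.inc v)) (n := s.ctr x) (T := 1)
      (fun m => s.set v (s.ctr v + m)) (Ne.symm ht.1)
      (by simp [Memory.set_ctr_of_ne _ _ (Ne.symm he.1)])
      (by simp [Memory.set_ctr_of_ne _ _ hv.symm, hs])
      (by simp [Memory.set_ctr_of_ne _ _ (Ne.symm he.1)])
      (by simp [Memory.set_ctr_of_ne _ _ hv.symm, hs])
      (fun m _ i k => by
        have h2 := Takes.inc (((s.set v (s.ctr v + m)).set x i).set .tmp k) v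
        rw [Memory.set_ctr_of_ne _ _ hv, Memory.set_ctr_of_ne _ _ he.1, Memory.set_ctr_self,
          Memory.set_comm _ _ _ hv.symm, Memory.set_comm _ _ _ (Ne.symm he.1),
          Memory.set_set] at h2
        exact h2)
    have h2 := ih (s := s.set v (s.ctr v + s.ctr x)) he.2 ht.2
      (by rw [Memory.set_ctr_of_ne _ _ hv.symm, hs])
      (fun y hy => by
        rw [Memory.set_ctr_of_ne _ _ (by rintro rfl; exact he.2 hy)]
        exact hB y (by simp [hy]))
    simp only [add_zero, Memory.set_eq_self rfl] at h1
    have h3 := h1.seq h2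
    have e1 : e.map (s.set v (s.ctr v + s.ctr x)).ctr = e.map s.ctr :=
      List.map_congr_left fun y hy =>
        Memory.set_ctr_of_ne _ _ (by rintro rfl; exact he.2 hy)
    rw [e1, Memory.set_set, Memory.set_ctr_self] at h3
    have hx := hB x (by simp)
    have h4 := h3.mono (T' := (x :: e).length * (7 * B + 2) + c + 1) (by
      rw [List.length_cons, add_mul]
      omega)
    rwa [add_assoc, ← add_assoc (s.ctr x), ← List.sum_cons, ← List.map_cons] at h4

/-- Subtracting a counter from another one, where the difference is `0` if it would be negative. -/
theorem takes_forEach_dec {x v : Ctr} {s : Memory} (hv : v ≠ .tmp) (hxv : x ≠ v) (ht : x ≠ .tmp)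
    (hs : s.ctr .tmp = 0) :
    Takes (.forEach x .tmp (.act (.dec v))) s (s.set v (s.ctr v - s.ctr x))
      (7 * s.ctr x + 2) := by
  have h1 := takes_forEach (x := x) (u := .tmp) (p := .act (.dec v)) (n := s.ctr x) (T := 1)
    (fun m => s.set v (s.ctr v - m)) ht
    (by simp [Memory.set_ctr_of_ne _ _ hxv]) (by simp [Memory.set_ctr_of_ne _ _ hv.symm, hs])
    (by simp [Memory.set_ctr_of_ne _ _ hxv]) (by simp [Memory.set_ctr_of_ne _ _ hv.symm, hs])
    (fun m _ i k => by
      have h2 := Takes.dec (((s.set v (s.ctr v - m)).set x i).set .tmp k) v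
      rw [Memory.set_ctr_of_ne _ _ hv, Memory.set_ctr_of_ne _ _ hxv.symm, Memory.set_ctr_self,
        Memory.set_comm _ _ _ hv.symm, Memory.set_comm _ _ _ hxv, Memory.set_set,
        Nat.sub_sub] at h2
      exact h2)
  simp only [Nat.sub_zero, Memory.set_eq_self rfl] at h1
  exact h1.mono (by omega)

/-- The memory after `k` letters have been moved from the input stack to the auxiliary stack. -/
def Memory.shifted (s : Memory) (k : ℕ) : Memory :=
  { s with inp := s.inp.drop k, aux := (s.inp.take k).reverse ++ s.aux }

theorem Memory.shifted_zero (s : Memory) : s.shifted 0 = s := by simp [shifted]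

theorem Memory.run_shift_shifted (s : Memory) (k : ℕ) :
    Instr.shift.run (s.shifted k) = s.shifted (k + 1) := by
  simp only [shifted, Instr.run, List.tail_drop, List.head?_drop, List.take_add_one,
    List.reverse_append]
  cases s.inp[k]? <;> simp

/-- Moving as many further letters as the value of `b` to the auxiliary stack. -/
theorem takes_forEach_shift {b : Ctr} {s : Memory} (k : ℕ) (hb : b ≠ .tmp)
    (hs : s.ctr .tmp = 0) :
    Takes (.forEach b .tmp (.act .shift)) (s.shifted k) (s.shifted (k + s.ctr b))
      (7 * s.ctr b + 2) := by
  have h1 := takes_forEach (x := b) (u := .tmp) (p := .act .shift) (n := s.ctr b) (T := 1)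
    (fun m => s.shifted (k + m)) hb rfl hs rfl hs (fun m _ i l => by
      have h2 := Takes.act .shift (((s.shifted (k + m)).set b i).set .tmp l)
      convert h2 using 1
      rw [← add_assoc, ← Memory.run_shift_shifted]
      rfl)
  exact h1.mono (by omega)

/-- Moving all letters on the auxiliary stack back to the input stack. -/
theorem takes_unshift {s : Memory} (k : ℕ) (hs : s.aux = []) :
    Takes (.while .auxMore (.act .unshift)) (s.shifted k) s (2 * s.inp.length + 1) := by
  have e : s.shifted k = s.shifted (min k s.inp.length) := by
    rcases le_total k s.inp.length with h | h
    · rw [min_eq_left h]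
    · rw [min_eq_right h, Memory.shifted, Memory.shifted, List.drop_of_length_le h,
        List.take_of_length_le h, List.drop_length, List.take_length]
  have h := Takes.loop (c := .auxMore) (p := .act .unshift) (T := 1) s.shifted
    (min k s.inp.length) (by simp [Test.holds, Memory.shifted, hs])
    (fun i hi => by
      have hi' : i < s.inp.length := by omega
      simp only [Test.holds, Memory.shifted, List.take_succ_eq_append_getElem hi',
        List.reverse_append]
      rfl)
    (fun i hi => by
      have hi' : i < s.inp.length := by omega
      have h2 := Takes.act .unshift (s.shifted (i + 1))
      convert h2 using 1
      simp only [Memory.shifted, Instr.run, List.take_succ_eq_append_getElem hi',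
        List.drop_eq_getElem_cons hi', List.reverse_append]
      simp)
  rw [Memory.shifted_zero, ← e] at h
  exact h.mono (by
    have := min_le_right k s.inp.length
    omega)

theorem takes_writeWord (l : List Token) (s : Memory) :
    Takes (.writeWord l) s (s.write l) (l.length + 1) := by
  induction l with
  | nil => exact Takes.act .nop s
  | cons t l ih => exact ih.seq (Takes.act (.emit t) _)

/-! ### Output generators -/

/-- Generators of words: nested loops over counters, with two kinds of tests. A generator reads the
counters and the bits on the input stack, and changes nothing but the output. -/
inductive Gen : Type
  | word (l : List Token) : Gen
  | seq (g h : Gen) : Gen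
  /-- repeat `g` with the values `0, 1, …` of `v`, as many as the sum of the counters `e` and of the
  constant `c` -/
  | loop (v : Ctr) (e : List Ctr) (c : ℕ) (g : Gen) : Gen
  /-- `g` if the counter `x` is at most the counter `y`, else `h` -/
  | ifLe (x y : Ctr) (g h : Gen) : Gen
  /-- `g` if the bit in row `x` and column `y` of the input is `true`, else `h`, where the rows have
  length `b` -/
  | ifBit (x y b : Ctr) (g h : Gen) : Gen

namespace Gen

/-- The word that is generated. -/
def eval : Gen → (Ctr → ℕ) → List Bool → List Token
  | word l, _, _ => l
  | seq g h, env, bits => g.eval env bits ++ h.eval env bits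
  | loop v e c g, env, bits => (List.range ((e.map env).sum + c)).flatMap fun i =>
      g.eval (Function.update env v i) bits
  | ifLe x y g h, env, bits => if env x ≤ env y then g.eval env bits else h.eval env bits
  | ifBit x y b g h, env, bits =>
      if bits[env x * env b + env y]? = some true then g.eval env bits else h.eval env bits

/-- Scoping: only counters of `S` and variables of enclosing loops are read, and every loop
has a variable of its own. -/
def Scoped : Gen → Finset Ctr → Prop
  | word _, _ => True
  | seq g h, S => g.Scoped S ∧ h.Scoped S
  | loop v e _ g, S =>
    v ∉ S ∧ v ≠ .tmp ∧ v ≠ .acc ∧ (∀ x ∈ e, x ∈ S) ∧ g.Scoped (insert v S)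
  | ifLe x y g h, S => x ∈ S ∧ y ∈ S ∧ g.Scoped S ∧ h.Scoped S
  | ifBit x y b g h, S => x ∈ S ∧ y ∈ S ∧ b ∈ S ∧ g.Scoped S ∧ h.Scoped S

/-- The program for a generator. Loops run downwards, and parts are written in reverse order, as the
output grows at its front. -/
def compile : Gen → Prog
  | word l => .writeWord l
  | seq g h => .seq h.compile g.compile
  | loop v e c g =>
    .seq (.addTo v e c) (.while (.pos v) (.seq (.act (.dec v)) g.compile))
  | ifLe x y g h =>
    .seq (.addTo .acc [x] 0) (.seq (.forEach y .tmp (.act (.dec .acc)))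
      (.ite (.pos .acc) (.seq (.clear .acc) h.compile) g.compile))
  | ifBit x y b g h =>
    .seq (.addTo .acc [x] 0) (.seq
      (.while (.pos .acc) (.seq (.act (.dec .acc)) (.forEach b .tmp (.act .shift))))
      (.seq (.forEach y .tmp (.act .shift))
        (.ite .bit (.seq (.while .auxMore (.act .unshift)) g.compile)
          (.seq (.while .auxMore (.act .unshift)) h.compile))))

open Polynomial in
/-- A bound for the running time in terms of a common bound for the counters and for the number of
bits. Inside a loop this common bound grows by the bound of the loop variable, whence `comp`. -/
noncomputable def cost : Gen → Polynomial ℕ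
  | word l => C (l.length + 1)
  | seq g h => g.cost + h.cost
  | loop _ e c g => (C e.length * (7 * X + 2) + C (c + 1)) +
      ((C e.length * X + C c) * (g.cost.comp (X + (C e.length * X + C c)) + 2) + 1)
  | ifLe _ _ g h => 16 * X + 10 + g.cost + h.cost
  | ifBit _ _ _ g h => X * (7 * X + 4) + 16 * X + 10 + g.cost + h.cost

end Gen

/-- The program of a generator writes the value of the generator, restores everything else, and obeys
the time bound. -/
theorem Gen.takes_compile (g : Gen) {S : Finset Ctr} {s : Memory} {B : ℕ} (hg : g.Scoped S)
    (ht : .tmp ∉ S) (ha : .acc ∉ S) (h₀ : ∀ v ∉ S, s.ctr v = 0) (haux : s.aux = [])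
    (hB : ∀ v, s.ctr v ≤ B) (hinp : s.inp.length ≤ B) :
    Takes g.compile s (s.write (g.eval s.ctr s.inp)) (g.cost.eval B) := by
  induction g generalizing S s B with
  | word l =>
    refine (takes_writeWord l s).mono ?_
    simp [cost]
  | seq g h ihg ihh =>
    have h1 := (ihh hg.2 ht ha h₀ haux hB hinp).seq
      (ihg (s := s.write (h.eval s.ctr s.inp)) hg.1 ht ha h₀ haux hB hinp)
    rw [Memory.write_write, add_comm] at h1
    rw [cost, Polynomial.eval_add]
    exact h1
  | loop v e c g ih =>
    obtain ⟨hvS, hvt, hva, he, hg⟩ := hg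
    have h1 := takes_addTo (v := v) (e := e) (c := c) (s := s) (B := B) hvt
      (fun h => hvS (he v h)) (fun h => ht (he _ h)) (h₀ _ ht) (fun x _ => hB x)
    rw [h₀ v hvS, zero_add] at h1
    set n := (e.map s.ctr).sum + c with hn
    have hnB : n ≤ e.length * B + c := by
      have h2 := List.sum_le_card_nsmul (e.map s.ctr) B (by simp [hB])
      rw [List.length_map, smul_eq_mul] at h2
      omega
    have h2 := Takes.loop (c := .pos v) (p := .seq (.act (.dec v)) g.compile)
      (T := g.cost.eval (B + (e.length * B + c)) + 1)
      -- When the loop variable is `i`, the parts for `i, …, n - 1` have been written.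
      (fun i => (s.set v i).write (((List.range n).drop i).flatMap fun i =>
        g.eval (Function.update s.ctr v i) s.inp)) n
      (by simp [Test.holds]) (fun k _ => by simp [Test.holds])
      (fun k hk => by
        set L := ((List.range n).drop (k + 1)).flatMap fun i =>
          g.eval (Function.update s.ctr v i) s.inp with hL
        have hd : Takes (.act (.dec v)) ((s.set v (k + 1)).write L) ((s.set v k).write L) 1 := by
          have h3 := Takes.dec ((s.set v (k + 1)).write L) v
          rwa [Memory.write_set, Memory.set_set, Memory.write_ctr, Memory.set_ctr_self,
            Nat.add_sub_cancel] at h3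
        have h3 := ih (S := insert v S) (s := (s.set v k).write L)
          (B := B + (e.length * B + c)) hg (by simp [ht, hvt.symm]) (by simp [ha, hva.symm])
          (fun w hw => by
            rw [Finset.mem_insert, not_or] at hw
            rw [Memory.write_ctr, Memory.set_ctr_of_ne _ _ hw.1, h₀ w hw.2]) haux
          (fun w => by
            rw [Memory.write_ctr]
            rcases eq_or_ne w v with rfl | hw
            · rw [Memory.set_ctr_self]
              omega
            · rw [Memory.set_ctr_of_ne _ _ hw]
              exact (hB w).trans (by omega))
          (by
            change s.inp.length ≤ _
            omega)
        rw [Memory.write_write] at h3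
        rw [List.drop_eq_getElem_cons (by simpa using hk), List.flatMap_cons, ← hL,
          List.getElem_range]
        exact (hd.seq h3).mono (by omega))
    simp only [List.drop_zero, Memory.set_eq_self (h₀ v hvS)] at h2
    rw [List.drop_of_length_le (by simp), List.flatMap_nil, Memory.write_nil] at h2
    refine (h1.seq h2).mono ?_
    simp only [cost, Polynomial.eval_add, Polynomial.eval_mul, Polynomial.eval_C,
      Polynomial.eval_X, Polynomial.eval_comp, Polynomial.eval_ofNat, Polynomial.eval_one]
    refine Nat.add_le_add (le_of_eq (by ring)) (Nat.add_le_add_right ?_ 1)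
    exact Nat.mul_le_mul hnB le_rfl
  | ifLe x y g h ihg ihh =>
    obtain ⟨hx, hy, hg, hh⟩ := hg
    have hne : ∀ {w}, w ∈ S → w ≠ .tmp ∧ w ≠ .acc := fun hw =>
      ⟨by rintro rfl; exact ht hw, by rintro rfl; exact ha hw⟩
    have h1 := takes_addTo (v := .acc) (e := [x]) (c := 0) (s := s) (B := B) (by decide)
      (by simpa using (hne hx).2.symm) (by simpa using (hne hx).1.symm) (h₀ _ ht)
      (fun x _ => hB x)
    simp only [h₀ _ ha, List.map_cons, List.map_nil, List.sum_cons, List.sum_nil, zero_add,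
      add_zero, List.length_singleton, one_mul] at h1
    -- The truncated difference `x - y` in `acc` is `0` if and only if `x ≤ y`.
    have h2 := takes_forEach_dec (x := y) (v := .acc) (s := s.set .acc (s.ctr x)) (by decide)
      (hne hy).2 (hne hy).1 (by rw [Memory.set_ctr_of_ne _ _ (by decide), h₀ _ ht])
    rw [Memory.set_set, Memory.set_ctr_self, Memory.set_ctr_of_ne _ _ (hne hy).2] at h2
    have hBx := hB x
    have hBy := hB y
    have e1 : (cost (.ifLe x y g h)).eval B = 16 * B + 10 + g.cost.eval B + h.cost.eval B := by
      simp [cost]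
    rw [e1, eval]
    split_ifs with hxy
    · rw [Nat.sub_eq_zero_of_le hxy, Memory.set_eq_self (h₀ _ ha)] at h2
      have h3 := h1.seq (h2.seq (Takes.ite_false (c := .pos .acc)
        (p := .seq (.clear .acc) h.compile) (by simp [Test.holds, h₀ _ ha])
        (ihg hg ht ha h₀ haux hB hinp)))
      exact h3.mono (by omega)
    · have h4 := takes_clear .acc (s.set .acc (s.ctr x - s.ctr y))
      rw [Memory.set_set, Memory.set_ctr_self, Memory.set_eq_self (h₀ _ ha)] at h4
      have h3 := h1.seq (h2.seq (Takes.ite_true (c := .pos .acc) (q := g.compile)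
        (by simpa [Test.holds] using hxy) (h4.seq (ihh hh ht ha h₀ haux hB hinp))))
      exact h3.mono (by omega)
  | ifBit x y b g h ihg ihh =>
    obtain ⟨hx, hy, hb, hg, hh⟩ := hg
    have hne : ∀ {w}, w ∈ S → w ≠ .tmp ∧ w ≠ .acc := fun hw =>
      ⟨by rintro rfl; exact ht hw, by rintro rfl; exact ha hw⟩
    have h1 := takes_addTo (v := .acc) (e := [x]) (c := 0) (s := s) (B := B) (by decide)
      (by simpa using (hne hx).2.symm) (by simpa using (hne hx).1.symm) (h₀ _ ht)
      (fun x _ => hB x)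
    simp only [h₀ _ ha, List.map_cons, List.map_nil, List.sum_cons, List.sum_nil, zero_add,
      add_zero, List.length_singleton, one_mul] at h1
    -- Moving `x * b + y` letters away exposes the bit in question.
    have h2 := Takes.loop (c := .pos .acc)
      (p := .seq (.act (.dec .acc)) (.forEach b .tmp (.act .shift))) (T := 7 * s.ctr b + 3)
      (fun i => (s.set .acc i).shifted ((s.ctr x - i) * s.ctr b)) (s.ctr x)
      (by simp [Test.holds, Memory.shifted])
      (fun k _ => by simp [Test.holds, Memory.shifted])
      (fun k hk => by
        have h3 := Takes.dec ((s.set .acc (k + 1)).shifted ((s.ctr x - (k + 1)) * s.ctr b)) .acc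
        have e2 : ((s.set .acc (k + 1)).shifted ((s.ctr x - (k + 1)) * s.ctr b)).set .acc
            (((s.set .acc (k + 1)).shifted ((s.ctr x - (k + 1)) * s.ctr b)).ctr .acc - 1) =
            (s.set .acc k).shifted ((s.ctr x - (k + 1)) * s.ctr b) := by
          simp [Memory.shifted, Memory.set]
        rw [e2] at h3
        have h4 := takes_forEach_shift (b := b) (s := s.set .acc k)
          ((s.ctr x - (k + 1)) * s.ctr b) (hne hb).1
          (by rw [Memory.set_ctr_of_ne _ _ (by decide), h₀ _ ht])
        rw [Memory.set_ctr_of_ne _ _ (hne hb).2, ← add_one_mul,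
          show s.ctr x - (k + 1) + 1 = s.ctr x - k by omega] at h4
        exact (h3.seq h4).mono (by omega))
    simp only [Nat.sub_self, zero_mul, Memory.shifted_zero, Nat.sub_zero,
      Memory.set_eq_self (h₀ _ ha)] at h2
    have h3 := takes_forEach_shift (b := y) (s := s) (s.ctr x * s.ctr b) (hne hy).1 (h₀ _ ht)
    have h4 := takes_unshift (s.ctr x * s.ctr b + s.ctr y) haux
    have hc : Test.bit.holds (s.shifted (s.ctr x * s.ctr b + s.ctr y)) =
        decide (s.inp[s.ctr x * s.ctr b + s.ctr y]? = some true) := by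
      simp only [Test.holds, Memory.shifted, List.head?_drop]
      rcases s.inp[s.ctr x * s.ctr b + s.ctr y]? with - | ⟨_ | _⟩ <;> rfl
    have hBx := hB x
    have hBy := hB y
    have hBb := hB b
    have hBxb : s.ctr x * (7 * s.ctr b + 3 + 1) ≤ B * (7 * B + 4) :=
      Nat.mul_le_mul hBx (by omega)
    have e1 : (cost (.ifBit x y b g h)).eval B =
        B * (7 * B + 4) + 16 * B + 10 + g.cost.eval B + h.cost.eval B := by
      simp [cost]
    rw [e1, eval]
    split_ifs with hbit
    · have h5 := h1.seq (h2.seq (h3.seq (Takes.ite_true (c := .bit)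
        (q := .seq (.while .auxMore (.act .unshift)) h.compile) (by simpa [hc] using hbit)
        (h4.seq (ihg hg ht ha h₀ haux hB hinp)))))
      exact h5.mono (by omega)
    · have h5 := h1.seq (h2.seq (h3.seq (Takes.ite_false (c := .bit)
        (p := .seq (.while .auxMore (.act .unshift)) g.compile) (by simpa [hc] using hbit)
        (h4.seq (ihh hh ht ha h₀ haux hB hinp)))))
      exact h5.mono (by omega)

/-! ### Lists, tables and encodings -/

theorem flatMap_filter_eq {α β : Type} (p : α → Bool) (f : α → List β)
    (l : List α) :
    (l.filter p).flatMap f = l.flatMap fun a => if p a then f a else [] := by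
  induction l with
  | nil => rfl
  | cons a l ih => by_cases h : p a <;> simp [h, ih]

theorem flatMap_finRange {β : Type} {n : ℕ} {f : Fin n → List β} {f' : ℕ → List β}
    (h : ∀ i : Fin n, f' i = f i) : (List.range n).flatMap f' = (List.finRange n).flatMap f := by
  rw [← List.map_coe_finRange_eq_range, List.flatMap_map]
  exact List.flatMap_congr fun i _ => h i

/-- The letter in row `x` and column `y` of a table that is written row by row. -/
theorem getElem?_table {α : Type} {m n : ℕ} (f : Fin m → Fin n → α) (x : Fin m) (y : Fin n) :
    ((List.finRange m).flatMap fun x => (List.finRange n).map (f x))[x * n + y]? =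
      some (f x y) := by
  have key : ∀ (l : List (Fin m)) (k : ℕ),
      (l.flatMap fun x => (List.finRange n).map (f x))[k * n + y]? = l[k]?.map fun x => f x y := by
    intro l
    induction l with
    | nil => simp
    | cons a l ih =>
      intro k
      rw [List.flatMap_cons]
      cases k with
      | zero =>
        rw [List.getElem?_append_left (by simp)]
        simp
      | succ k =>
        rw [List.getElem?_append_right (by simp; nlinarith [y.2])]
        simp only [List.length_map, List.length_finRange]
        rw [show (k + 1) * n + y - n = k * n + y by rw [add_one_mul]; omega, ih]
        simp
  rw [key]
  simp

theorem encodeSet_empty : encodeSet ∅ = [.close] := by simp [encodeSet]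

theorem encodeSet_singleton (k : ℕ) : encodeSet {k} = encodeName k ++ [.close] := by
  simp [encodeSet]

theorem sort_Icc_one (n : ℕ) :
    (Finset.Icc 1 n).sort (· ≤ ·) = (List.range n).map (· + 1) := by
  have h : (List.range n).map (· + 1) = List.range' 1 n := by
    rw [List.range'_eq_map_range]
    exact List.map_congr_left fun i _ => add_comm _ _
  rw [h]
  refine List.Perm.eq_of_pairwise (le := (· ≤ ·)) (fun _ _ _ _ h1 h2 => le_antisymm h1 h2)
    (Finset.pairwise_sort _ _) ?_ ?_
  · exact List.pairwise_le_range'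
  · rw [List.perm_ext_iff_of_nodup (Finset.sort_nodup _ _) List.nodup_range']
    intro a
    simp [List.mem_range'_1]
    omega

open Classical in
/-- The adjacency matrix of a graph, row by row. -/
noncomputable def matrix (g : RootedGraph) : List Bool :=
  (List.finRange g.nodes).flatMap fun x =>
    (List.finRange g.nodes).map fun y => decide (g.graph.Adj x y)

theorem encodeFormula_bot : encodeFormula .bot = [.neg, .imp, .atom, .sep, .atom, .sep] := by
  simp [Formula.bot, encodeFormula, encodeName]

theorem encodeFormula_or (φ ψ : Formula) :
    encodeFormula (φ.or ψ) = .imp :: .neg :: (encodeFormula φ ++ encodeFormula ψ) := by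
  simp [Formula.or, encodeFormula]

theorem encodeFormula_and (φ ψ : Formula) :
    encodeFormula (φ.and ψ) = .neg :: .imp :: (encodeFormula φ ++ .neg :: encodeFormula ψ) := by
  simp [Formula.and, encodeFormula]

theorem encodeFormula_bigOr (l : List Formula) :
    encodeFormula (Formula.bigOr l) =
      l.flatMap (fun φ => .imp :: .neg :: encodeFormula φ) ++ encodeFormula .bot := by
  induction l with
  | nil => rfl
  | cons φ l ih =>
    have : Formula.bigOr (φ :: l) = φ.or (Formula.bigOr l) := rfl
    rw [this, encodeFormula_or, ih]
    simp

/-! ### The generator of the induced instance -/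

namespace Gen

instance : Append Gen := ⟨seq⟩

theorem eval_append (g h : Gen) (env : Ctr → ℕ) (bits : List Bool) :
    (g ++ h).eval env bits = g.eval env bits ++ h.eval env bits := rfl

theorem scoped_append (g h : Gen) (S : Finset Ctr) :
    (g ++ h).Scoped S ↔ g.Scoped S ∧ h.Scoped S := Iff.rfl

/-- As many ticks as the sum of the counters `e` and the constant `c`. -/
def ticks (e : List Ctr) (c : ℕ) : Gen := loop .tick e c (word [.tick])

/-- The name whose number is the sum of the counters `e` and the constant `c`. -/
def name (e : List Ctr) (c : ℕ) : Gen := ticks e c ++ word [.sep]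

/-- The formula `⊥`. -/
def bot : Gen := word [.neg, .imp, .atom, .sep, .atom, .sep]

/-- The formula `psi` of the agent `2 * v + c + 1`. -/
def psi (v : Ctr) (c : ℕ) : Gen :=
  word [.neg, .imp, .neg, .know] ++ name [v, v] (c + 1) ++ bot ++ word [.neg] ++
    loop .fst [.nodes] 0 (word [.imp, .neg, .know] ++ name [v, v] (c + 1) ++ word [.atom] ++
      name [.fst] 0) ++ bot

/-- The formula `chi` of the agent `2 * v + c + 1`; the loop variable `agent` is `j - 1`. -/
def chi (v : Ctr) (c : ℕ) : Gen :=
  let disjunct := word [.imp, .neg, .neg, .imp, .atom] ++ name [.fst] 0 ++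
    word [.neg, .neg, .imp, .neg, .know] ++ name [.agent] 1 ++ word [.neg, .atom] ++
    name [.snd] 0 ++ word [.neg, .know] ++ name [v, v] (c + 1) ++ word [.atom] ++ name [.snd] 0
  loop .agent [v, v] c (loop .fst [.nodes] 0 (loop .snd [.nodes] 0
    (ifLe .fst .snd (ifLe .snd .fst (word []) disjunct) disjunct))) ++ bot

/-- The part of the induced formula for round `v` that is common to all rounds. The rounds are
counted from `0`, and the agents of round `v` are `2 * v + 1` and `2 * v + 2`. -/
def roundStart (v : Ctr) : Gen :=
  word [.neg, .boxplus] ++ name [v, v] 1 ++ word [.neg, .neg, .imp] ++ psi v 0 ++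
    word [.neg, .neg, .imp, .neg] ++ chi v 0 ++ word [.neg, .know] ++ name [v, v] 1 ++
    word [.boxplus] ++ name [v, v] 2 ++ word [.imp, .neg, .neg] ++ psi v 1

/-- The remaining part of the induced formula for round `v`, up to the next round. -/
def roundLink (v : Ctr) : Gen :=
  word [.imp, .neg] ++ chi v 1 ++ word [.neg, .know] ++ name [v, v] 2 ++ word [.neg]

/-- The induced formula. -/
def formula : Gen :=
  loop .round [.rounds] 0 (roundStart .round ++ roundLink .round) ++ roundStart .rounds ++
    chi .rounds 1

/-- The table of the edge function. The number of a skill is written as `min x y` blocks of as many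
ticks as there are nodes, followed by `max x y` ticks. -/
def edgeTable : Gen :=
  loop .fst [.nodes] 0 (loop .snd [.nodes] 0 (ifBit .fst .snd .nodes
    (ifLe .fst .snd (loop .agent [.fst] 0 (ticks [.nodes] 0) ++ ticks [.snd] 0)
      (loop .agent [.snd] 0 (ticks [.nodes] 0) ++ ticks [.fst] 0) ++ word [.sep, .close])
    (word [.close])))

/-- The induced instance of the model checking problem. -/
def inducedInstance : Gen :=
  name [.nodes] 0 ++ (name [.root] 0 ++ (edgeTable ++
    ((loop .agent [.rounds, .rounds] 2 (name [.agent] 1) ++ word [.close]) ++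
      (loop .agent [.rounds, .rounds] 2 (word [.close]) ++
        (loop .fst [.nodes] 0 (name [.fst] 0 ++ word [.close]) ++ formula)))))

theorem scoped_inducedInstance : inducedInstance.Scoped {.nodes, .root, .rounds} := by
  simp [inducedInstance, name, ticks, edgeTable, formula, roundStart, roundLink, psi, chi, bot,
    Scoped, scoped_append]

variable {env : Ctr → ℕ} {bits : List Bool}

theorem eval_ticks (e : List Ctr) (c : ℕ) :
    (ticks e c).eval env bits = List.replicate ((e.map env).sum + c) .tick := by
  simp [ticks, eval, List.flatMap_def]

theorem eval_name (e : List Ctr) (c : ℕ) :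
    (name e c).eval env bits = encodeName ((e.map env).sum + c) := by
  simp [name, eval_append, eval_ticks, eval, encodeName]

theorem eval_psi {v : Ctr} (hv : v = .round ∨ v = .rounds) (c : ℕ) :
    (psi v c).eval env bits =
      encodeFormula (EpistemicSkills.psi (env .nodes) (2 * env v + c + 1)) := by
  have hvf : v ≠ .fst := by rcases hv with rfl | rfl <;> decide
  simp [psi, bot, EpistemicSkills.psi, eval_append, eval_name, eval, encodeFormula_and,
    encodeFormula_bigOr, encodeFormula_bot, encodeFormula, List.flatMap_map, hvf, ← add_assoc,
    ← two_mul]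

theorem eval_chi {v : Ctr} (hv : v = .round ∨ v = .rounds) (c : ℕ) :
    (chi v c).eval env bits =
      encodeFormula (EpistemicSkills.chi (env .nodes) (2 * env v + c + 1)) := by
  have h1 : v ≠ .fst := by rcases hv with rfl | rfl <;> decide
  have h2 : v ≠ .snd := by rcases hv with rfl | rfl <;> decide
  have h3 : v ≠ .agent := by rcases hv with rfl | rfl <;> decide
  simp only [chi, EpistemicSkills.chi, eval_append, encodeFormula_bigOr, encodeFormula_bot,
    List.flatMap_assoc, List.flatMap_map, flatMap_filter_eq, Nat.add_sub_cancel,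
    List.range'_eq_map_range]
  refine congrArg₂ _ ?_ rfl
  simp only [eval, eval_append, eval_name]
  simp only [List.map_cons, List.map_nil, List.sum_cons, List.sum_nil, add_zero, ← two_mul]
  refine List.flatMap_congr fun i _ => ?_
  rw [Function.update_of_ne (by decide)]
  refine List.flatMap_congr fun x _ => ?_
  rw [Function.update_of_ne (by decide), Function.update_of_ne (by decide)]
  refine List.flatMap_congr fun y _ => ?_
  have hxy : (decide (x ≠ y) = true) ↔ ¬ (x ≤ y ∧ y ≤ x) := by
    rw [decide_eq_true_eq]
    omega
  simp only [hxy, Function.update_self, ne_eq, reduceCtorEq, not_false_eq_true,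
    Function.update_of_ne, h1, h2, h3]
  split_ifs <;>
    simp_all [encodeFormula_and, Formula.possible, encodeFormula, add_comm 1 i,
      add_assoc]

theorem eval_roundStart {v : Ctr} (hv : v = .round ∨ v = .rounds) {i : ℕ} (hi : i = 2 * env v + 1)
    (φ : Formula) :
    (roundStart v).eval env bits ++ encodeFormula φ = encodeFormula (.diamondplus i
      ((EpistemicSkills.psi (env .nodes) i).and ((EpistemicSkills.chi (env .nodes) i).neg.and
        (.know i (.boxplus (i + 1)
          ((EpistemicSkills.psi (env .nodes) (i + 1)).neg.or φ)))))) := by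
  subst hi
  simp [roundStart, eval_append, eval_name, eval_psi hv, eval_chi hv, eval, encodeFormula_and,
    encodeFormula_or, Formula.diamondplus, encodeFormula, ← two_mul]

theorem eval_roundLink {v : Ctr} (hv : v = .round ∨ v = .rounds) {i : ℕ} (hi : i = 2 * env v + 1)
    (φ : Formula) :
    (roundLink v).eval env bits ++ encodeFormula φ = encodeFormula
      ((EpistemicSkills.chi (env .nodes) (i + 1)).or (.possible (i + 1) φ)) := by
  subst hi
  simp [roundLink, eval_append, eval_name, eval_chi hv, eval,
    encodeFormula_or, Formula.possible, encodeFormula, ← two_mul]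

/-- The rounds from `k` on, of which the last one has no link to a next round. -/
theorem eval_rounds {r k : ℕ} (h : k + r = env .rounds) :
    ((List.range r).flatMap fun i => (roundStart .round ++ roundLink .round).eval
        (Function.update env .round (k + i)) bits) ++
      ((roundStart .rounds).eval env bits ++ (chi .rounds 1).eval env bits) =
    encodeFormula (phiFrom (env .nodes) r (2 * k + 1)) := by
  induction r generalizing k with
  | zero =>
    obtain rfl : k = env .rounds := h
    rw [eval_chi (.inr rfl), eval_roundStart (.inr rfl) rfl]
    rfl
  | succ r ih =>
    have h1 := ih (k := k + 1) (by omega)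
    rw [List.range_succ_eq_map, List.flatMap_cons, List.flatMap_map, List.append_assoc]
    have e : ∀ i, Function.update env .round (k + Nat.succ i) =
        Function.update env .round (k + 1 + i) := fun i => by
      rw [Nat.succ_eq_add_one, add_assoc, add_comm 1]
    simp only [e]
    rw [h1, eval_append, List.append_assoc, eval_roundLink (.inl rfl) (i := 2 * k + 1) (by simp),
      eval_roundStart (.inl rfl) (i := 2 * k + 1) (by simp)]
    rfl

theorem eval_formula :
    formula.eval env bits = encodeFormula (phiFrom (env .nodes) (env .rounds) 1) := by
  have h := eval_rounds (env := env) (bits := bits) (zero_add (env .rounds))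
  simp only [zero_add, mul_zero] at h
  rw [← h]
  simp [formula, eval_append, eval]

theorem eval_skill {n : ℕ} (x y : Fin n) (hn : env .nodes = n) (hx : env .fst = x)
    (hy : env .snd = y) :
    (ifLe .fst .snd (loop .agent [.fst] 0 (ticks [.nodes] 0) ++ ticks [.snd] 0)
      (loop .agent [.snd] 0 (ticks [.nodes] 0) ++ ticks [.fst] 0) ++ word [.sep, .close]).eval
        env bits = encodeSet {edgeSkill x y} := by
  have key : ∀ m, (List.range m).flatMap (fun _ => List.replicate n Token.tick) =
      List.replicate (n * m) Token.tick := by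
    intro m
    induction m with
    | zero => simp
    | succ m ih => simp [List.range_succ, ih, mul_add]
  rw [encodeSet_singleton]
  simp only [eval_append, eval, eval_ticks, hx, hy, edgeSkill, encodeName, List.map_cons,
    List.map_nil, List.sum_cons, List.sum_nil, add_zero, ne_eq, reduceCtorEq, not_false_eq_true,
    Function.update_of_ne, hn, key, List.replicate_append_replicate]
  rcases le_total x y with h | h
  · rw [if_pos (Fin.le_def.1 h), min_eq_left h, max_eq_right h]
    simp
  · rw [min_eq_right h, max_eq_left h]
    split_ifs with h1
    · obtain rfl : x = y := le_antisymm (Fin.le_def.2 h1) h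
      simp
    · simp

theorem eval_edgeTable (g : RootedGraph) (hn : env .nodes = g.nodes) (hb : bits = matrix g) :
    edgeTable.eval env bits = (List.finRange g.nodes).flatMap (fun w =>
      (List.finRange g.nodes).flatMap (fun u => encodeSet ((inducedModel g).E w u))) := by
  classical
  rw [edgeTable, eval]
  simp only [List.map_cons, List.map_nil, List.sum_cons, List.sum_nil, add_zero, hn]
  refine flatMap_finRange fun x => ?_
  rw [eval]
  simp only [List.map_cons, List.map_nil, List.sum_cons, List.sum_nil, add_zero, ne_eq,
    reduceCtorEq, not_false_eq_true, Function.update_of_ne, hn]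
  refine flatMap_finRange fun y => ?_
  rw [eval, eval_skill x y (by simpa using hn) (by simp) (by simp)]
  simp only [ne_eq, reduceCtorEq, not_false_eq_true, Function.update_of_ne, Function.update_self,
    hn, hb, matrix]
  rw [getElem?_table]
  change _ = encodeSet (if g.graph.Adj x y then {edgeSkill x y} else ∅)
  by_cases h : g.graph.Adj x y <;> simp [h, eval, encodeSet_empty]

theorem eval_inducedInstance (g : RootedGraph) (hn : env .nodes = g.nodes)
    (hd : env .root = g.root) (hr : env .rounds = numAgents g / 2 - 1) (hb : bits = matrix g) :
    inducedInstance.eval env bits = encodeMC (EpistemicSkills.inducedInstance g) := by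
  classical
  have hN : env .rounds + env .rounds + 2 = numAgents g := by
    rw [hr]
    unfold numAgents
    omega
  have e1 : (loop .agent [.rounds, .rounds] 2 (name [.agent] 1) ++ word [.close]).eval env bits =
      encodeSet (Finset.Icc 1 (numAgents g)) := by
    simp [eval_append, eval, eval_name, encodeSet, sort_Icc_one, List.flatMap_map, hN]
  have e2 : (loop .agent [.rounds, .rounds] 2 (word [.close])).eval env bits =
      ((Finset.Icc 1 (numAgents g)).sort (· ≤ ·)).flatMap
        fun a => encodeSet ((inducedModel g).C a) := by
    change _ = ((Finset.Icc 1 (numAgents g)).sort (· ≤ ·)).flatMap fun _ => encodeSet ∅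
    simp [eval, encodeSet_empty, sort_Icc_one, List.flatMap_map, hN]
  have e3 : (loop .fst [.nodes] 0 (name [.fst] 0 ++ word [.close])).eval env bits =
      (List.finRange g.nodes).flatMap fun w => encodeSet ((inducedModel g).β w) := by
    rw [eval]
    simp only [List.map_cons, List.map_nil, List.sum_cons, List.sum_nil, add_zero, hn]
    refine flatMap_finRange fun x => ?_
    change _ = encodeSet {(x : ℕ)}
    simp [eval_append, eval, eval_name, encodeSet_singleton]
  have e4 : formula.eval env bits = encodeFormula (inducedFormula g) := by
    rw [eval_formula, hn, hr]
    rfl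
  simp only [inducedInstance, eval_append] at e1 ⊢
  rw [e1, e2, e3, e4, eval_edgeTable g hn hb]
  simp only [eval_name, List.map_cons, List.map_nil, List.sum_cons, List.sum_nil, add_zero, hn, hd]
  rfl

end Gen

/-! ### The whole program -/

namespace Prog

/-- Read a number that is written in unary. -/
def readUnary (v : Ctr) : Prog :=
  .seq (.while .bit (.seq (.act (.inc v)) (.act .drop))) (.act .drop)

/-- Count the occurrences of `true` on the input stack in the counter `acc`. -/
def countBits : Prog :=
  .seq (.while .more (.seq (.ite .bit (.act (.inc .acc)) (.act .nop)) (.act .shift)))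
    (.while .auxMore (.act .unshift))

/-- Empty `acc`, and add a quarter of its value to `rounds`, rounded up. -/
def quarter : Prog :=
  .while (.pos .acc) (.seq (.act (.dec .acc)) (.seq (.act (.dec .acc)) (.seq (.act (.dec .acc))
    (.seq (.act (.dec .acc)) (.act (.inc .rounds))))))

/-- The program that computes the reduction. The adjacency matrix has two ones for every edge, and a
round has two moves, so that a quarter of the number of ones, rounded up, is the number of rounds
(except that there is one round if there are no edges). The counter is then decreased by `1`, or
left at `0`, as `rounds` does not count the first round. -/
def reduction : Prog :=
  .seq (readUnary .nodes) (.seq (readUnary .root) (.seq countBits (.seq quarter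
    (.seq (.act (.dec .rounds)) (.seq Gen.inducedInstance.compile
      (.seq (clear .nodes) (.seq (clear .root) (.seq (clear .rounds)
        (.while .more (.act .drop))))))))))

end Prog

theorem takes_readUnary {v : Ctr} {s : Memory} {k : ℕ} {l : List Bool}
    (hs : s.inp = List.replicate k true ++ false :: l) :
    Takes (.readUnary v) s { s.set v (s.ctr v + k) with inp := l } (3 * k + 2) := by
  have h := Takes.loop (c := .bit) (p := .seq (.act (.inc v)) (.act .drop)) (T := 2)
    (fun i => { s.set v (s.ctr v + (k - i)) with inp := List.replicate i true ++ false :: l }) k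
    (by simp [Test.holds]) (fun i _ => by simp [Test.holds, List.replicate_succ])
    (fun i hi => by
      have h1 := (Takes.inc { s.set v (s.ctr v + (k - (i + 1))) with
        inp := List.replicate (i + 1) true ++ false :: l } v).seq (Takes.act .drop _)
      convert h1 using 1
      have e : s.ctr v + (k - i) = s.ctr v + (k - (i + 1)) + 1 := by omega
      rw [e]
      simp [Instr.run, Memory.set, List.replicate_succ])
  have h2 := h.seq (Takes.act .drop _)
  simp only [Nat.sub_self, add_zero, Nat.sub_zero, Memory.set_eq_self rfl, ← hs] at h2
  exact h2.mono (by omega)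

theorem takes_countBits {s : Memory} (haux : s.aux = []) (ha : s.ctr .acc = 0) :
    Takes .countBits s (s.set .acc (s.inp.count true)) (6 * s.inp.length + 2) := by
  set n := s.inp.length with hn
  have h := Takes.loop (c := .more)
    (p := .seq (.ite .bit (.act (.inc .acc)) (.act .nop)) (.act .shift)) (T := 3)
    (fun i => (s.set .acc ((s.inp.take (n - i)).count true)).shifted (n - i)) n
    (by simp [Test.holds, Memory.shifted, hn])
    (fun i hi => by
      have hlt : n - (i + 1) < s.inp.length := by omega
      simp [Test.holds, Memory.shifted, hlt])
    (fun i hi => by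
      have hlt : n - (i + 1) < s.inp.length := by omega
      have e : n - i = n - (i + 1) + 1 := by omega
      rw [e]
      generalize n - (i + 1) = m at hlt
      have hc : (s.inp.take (m + 1)).count true =
          (s.inp.take m).count true + if s.inp[m] = true then 1 else 0 := by
        rw [List.take_succ_eq_append_getElem hlt, List.count_append, List.count_singleton]
        simp
      have hb : Test.bit.holds ((s.set .acc ((s.inp.take m).count true)).shifted m) =
          s.inp[m] := by
        simp [Test.holds, Memory.shifted, hlt]
      have h1 : Takes (.ite .bit (.act (.inc .acc)) (.act .nop))
          ((s.set .acc ((s.inp.take m).count true)).shifted m)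
          ((s.set .acc ((s.inp.take (m + 1)).count true)).shifted m) 2 := by
        rw [hc]
        by_cases h2 : s.inp[m] = true
        · rw [if_pos h2]
          refine Takes.ite_true (hb.trans h2) ?_
          convert Takes.inc _ .acc using 1
          simp [Memory.shifted, Memory.set]
        · rw [if_neg h2]
          exact Takes.ite_false (hb.trans (by simpa using h2)) (Takes.act .nop _)
      have h2 := h1.seq (Takes.act .shift _)
      rwa [Memory.run_shift_shifted] at h2)
  have h2 := takes_unshift (s := s.set .acc (s.inp.count true)) n haux
  simp only [Nat.sub_self, Nat.sub_zero, List.take_zero, List.count_nil, hn, List.take_length,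
    Memory.set_eq_self ha, Memory.shifted_zero] at h h2
  exact (h.seq h2).mono (by simp only [Memory.set_inp]; omega)

theorem takes_quarter (s : Memory) :
    Takes .quarter s ((s.set .acc 0).set .rounds (s.ctr .rounds + (s.ctr .acc + 3) / 4))
      (6 * ((s.ctr .acc + 3) / 4) + 1) := by
  set m := (s.ctr .acc + 3) / 4 with hm
  have hd : ∀ a b, Takes (.act (.dec .acc)) ((s.set .acc a).set .rounds b)
      ((s.set .acc (a - 1)).set .rounds b) 1 := by
    intro a b
    have h := Takes.dec ((s.set .acc a).set .rounds b) .acc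
    rwa [Memory.set_ctr_of_ne _ _ (by decide), Memory.set_ctr_self,
      Memory.set_comm _ _ _ (show Ctr.rounds ≠ .acc by decide), Memory.set_set] at h
  have hi : ∀ a b, Takes (.act (.inc .rounds)) ((s.set .acc a).set .rounds b)
      ((s.set .acc a).set .rounds (b + 1)) 1 := by
    intro a b
    have h := Takes.inc ((s.set .acc a).set .rounds b) .rounds
    rwa [Memory.set_ctr_self, Memory.set_set] at h
  have h := Takes.loop (c := .pos .acc)
    (p := .seq (.act (.dec .acc)) (.seq (.act (.dec .acc)) (.seq (.act (.dec .acc))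
      (.seq (.act (.dec .acc)) (.act (.inc .rounds)))))) (T := 5)
    (fun i => (s.set .acc (s.ctr .acc - 4 * (m - i))).set .rounds (s.ctr .rounds + (m - i))) m
    (by
      simp only [Test.holds, Memory.set_ctr_of_ne _ _ (show Ctr.acc ≠ .rounds by decide),
        Memory.set_ctr_self, decide_eq_false_iff_not]
      omega)
    (fun i hi => by
      simp only [Test.holds, Memory.set_ctr_of_ne _ _ (show Ctr.acc ≠ .rounds by decide),
        Memory.set_ctr_self, decide_eq_true_eq]
      omega)
    (fun i hlt => by
      have h1 := (hd (s.ctr .acc - 4 * (m - (i + 1))) (s.ctr .rounds + (m - (i + 1)))).seq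
        ((hd _ _).seq ((hd _ _).seq ((hd _ _).seq (hi _ _))))
      have e1 : s.ctr .acc - 4 * (m - i) = s.ctr .acc - 4 * (m - (i + 1)) - 1 - 1 - 1 - 1 := by
        omega
      have e2 : s.ctr .rounds + (m - i) = s.ctr .rounds + (m - (i + 1)) + 1 := by omega
      rw [e1, e2]
      exact h1)
  simp only [Nat.sub_self, Nat.sub_zero, mul_zero, add_zero, Memory.set_eq_self rfl] at h
  rw [Nat.sub_eq_zero_of_le (by omega)] at h
  exact h.mono (by omega)

open Classical in
/-- By the handshake lemma, each edge is counted twice. -/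
theorem count_matrix (g : RootedGraph) : (matrix g).count true = 2 * g.edges := by
  have key : ∀ {α : Type} (l : List α) (p : α → Prop), (l.map fun a => decide (p a)).count true =
      (l.map fun a => if p a then 1 else 0).sum := by
    intro α l p
    induction l with
    | nil => rfl
    | cons a l ih => by_cases h : p a <;> simp [h, ih, add_comm]
  have h1 : g.edges = g.graph.edgeFinset.card := Set.ncard_eq_toFinset_card' _
  rw [h1, ← g.graph.sum_degrees_eq_twice_card_edges, matrix, List.count_flatMap,
    Fin.sum_univ_def]
  refine congrArg List.sum (List.map_congr_left fun x _ => ?_)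
  rw [Function.comp_apply, key, ← Fin.sum_univ_def, ← Finset.card_filter,
    ← SimpleGraph.card_neighborFinset_eq_degree, SimpleGraph.neighborFinset_eq_filter]

theorem length_encodeGraph (g : RootedGraph) :
    (encodeGraph g).length = g.nodes + g.root + 2 + (matrix g).length := by
  simp only [encodeGraph, matrix, List.length_append, List.length_cons, List.length_replicate]
  ring

theorem takes_drop (s : Memory) :
    Takes (.while .more (.act .drop)) s { s with inp := [] } (2 * s.inp.length + 1) := by
  have h := Takes.loop (c := .more) (p := .act .drop) (T := 1)
    (fun i => { s with inp := s.inp.drop (s.inp.length - i) }) s.inp.length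
    (by simp [Test.holds])
    (fun i hi => by
      have hlt : s.inp.length - (i + 1) < s.inp.length := by omega
      simp [Test.holds, hlt])
    (fun i hi => by
      have h1 := Takes.act .drop { s with inp := s.inp.drop (s.inp.length - (i + 1)) }
      convert h1 using 1
      have e : s.inp.length - i = s.inp.length - (i + 1) + 1 := by omega
      simp only [Instr.run, List.tail_drop, e])
  simp only [Nat.sub_self, List.drop_zero, Nat.sub_zero, List.drop_length] at h
  exact h.mono (by omega)

/-- The counters with the values `n`, `d`, `a` and `r` of `nodes`, `root`, `acc` and `rounds`. -/
def params (n d a r : ℕ) : Ctr → ℕ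
  | .nodes => n
  | .root => d
  | .acc => a
  | .rounds => r
  | _ => 0

section

variable (n d a r k : ℕ)

theorem update_params_nodes : Function.update (params n d a r) .nodes k = params k d a r := by
  funext v
  cases v <;> rfl

theorem update_params_root : Function.update (params n d a r) .root k = params n k a r := by
  funext v
  cases v <;> rfl

theorem update_params_acc : Function.update (params n d a r) .acc k = params n d k r := by
  funext v
  cases v <;> rfl

theorem update_params_rounds : Function.update (params n d a r) .rounds k = params n d a k := by
  funext v
  cases v <;> rfl

theorem params_zero : params 0 0 0 0 = fun _ => 0 := by
  funext v
  cases v <;> rfl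

end

open Polynomial in
/-- The program of the reduction runs in polynomial time and leaves nothing but its output. -/
theorem takes_reduction (g : RootedGraph) :
    Takes .reduction ⟨encodeGraph g, [], [], fun _ => 0⟩
      ⟨[], [], encodeMC (inducedInstance g), fun _ => 0⟩
      ((Gen.inducedInstance.cost + 40 * X + 40).eval (encodeGraph g).length) := by
  have hL := length_encodeGraph g
  set L := (encodeGraph g).length with hLdef
  have hroot := g.root.2
  have hc := count_matrix g
  have hcl : (matrix g).count true ≤ (matrix g).length := List.count_le_length
  set R := numAgents g / 2 - 1 with hR
  have hR2 : ((matrix g).count true + 3) / 4 - 1 = R := by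
    rw [hR, hc]
    unfold numAgents
    omega
  have h1 := takes_readUnary (v := .nodes) (s := ⟨encodeGraph g, [], [], params 0 0 0 0⟩)
    (k := g.nodes) rfl
  have h2 := takes_readUnary (v := .root) (k := g.root) (l := matrix g)
    (s := ⟨List.replicate (g.root : ℕ) true ++ false :: matrix g, [], [], params g.nodes 0 0 0⟩)
    rfl
  have h3 := takes_countBits (s := ⟨matrix g, [], [], params g.nodes g.root 0 0⟩) rfl rfl
  have h4 := takes_quarter
    ⟨matrix g, [], [], params g.nodes g.root ((matrix g).count true) 0⟩
  have h5 := Takes.dec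
    ⟨matrix g, [], [], params g.nodes g.root 0 (((matrix g).count true + 3) / 4)⟩ .rounds
  have h6 := Gen.inducedInstance.takes_compile (B := L)
    (s := ⟨matrix g, [], [], params g.nodes g.root 0 R⟩) Gen.scoped_inducedInstance
    (by decide) (by decide)
    (fun v hv => by
      cases v with
      | nodes | root | rounds => simp at hv
      | _ => rfl)
    rfl
    (fun v => by
      cases v with
      | nodes =>
        change g.nodes ≤ L
        omega
      | root =>
        change (g.root : ℕ) ≤ L
        omega
      | rounds =>
        change R ≤ L
        omega
      | _ => exact Nat.zero_le _)
    (by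
      change (matrix g).length ≤ L
      omega)
  rw [Gen.eval_inducedInstance g rfl rfl hR rfl] at h6
  set w := encodeMC (inducedInstance g) with hw
  have h7 := takes_clear .nodes ⟨matrix g, [], w, params g.nodes g.root 0 R⟩
  have h8 := takes_clear .root ⟨matrix g, [], w, params 0 g.root 0 R⟩
  have h9 := takes_clear .rounds ⟨matrix g, [], w, params 0 0 0 R⟩
  have h10 := takes_drop ⟨matrix g, [], w, params 0 0 0 0⟩
  have e3 : ∀ n d a r, params n d a r .rounds = r := fun _ _ _ _ => rfl
  have e4 : ∀ n d a r, params n d a r .acc = a := fun _ _ _ _ => rfl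
  have e5 : ∀ n d a r, params n d a r .root = d := fun _ _ _ _ => rfl
  have e6 : ∀ n d a r, params n d a r .nodes = n := fun _ _ _ _ => rfl
  simp only [Memory.set, Memory.write, update_params_nodes, update_params_root, update_params_acc,
    update_params_rounds, hR2, e3, e4, e5, e6, zero_add, List.append_nil]
    at h1 h2 h3 h4 h5 h6 h7 h8 h9 h10
  rw [← params_zero]
  have h := h1.seq (h2.seq (h3.seq (h4.seq (h5.seq (h6.seq (h7.seq (h8.seq (h9.seq h10))))))))
  refine h.mono ?_
  simp only [eval_add, eval_mul, eval_ofNat, eval_X]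
  omega

end EpistemicSkills

theorem mainTheorem5 :
    PolyTimeReducible encodingGraph encodingMC UEG ModelChecking ∧
    IsPolyTimeReduction encodingGraph encodingMC UEG ModelChecking inducedInstance ∧
    ∃ p : Polynomial ℕ, ∀ g : RootedGraph,
      (inducedModel g).size ≤ p.eval (g.nodes + g.edges) ∧
      (inducedFormula g).length ≤ p.eval (g.nodes + g.edges) := by
  have h : IsPolyTimeReduction encodingGraph encodingMC UEG ModelChecking inducedInstance :=
    ⟨Prog.computableInPolyTime .reduction _ takes_reduction, uEG_iff_modelChecking⟩
  exact ⟨⟨_, h⟩, h, exists_polynomial_bound⟩
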